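/- **Setting.** Let $d\ge 1$, and let $\mathbf J=(J_x)_{x\in\mathbb Z^d}$ satisfy $J_x=J_{-x}\ge 0$, $J_x=0$ for $|x|>R$ (some $R>0$), and $J_x>0$ for $|x|=1$. Bonds are the unordered pairs $(x,y)$, $x\ne y$, with $J_{y-x}>0$. Let $q\ge1$, $\beta>0$ and $p_e=1-e^{-2\beta J_e}$. For finite $\Lambda\subset\mathbb Z^d$ and a bond configuration $\eta$, $\mathbb P^\eta_\Lambda$ gives to each configuration $\omega$ that agrees with $\eta$ on all bonds not contained in $\Lambda$ a probability proportional to $q^{\mathfrak N_\Lambda(\omega)}\prod_{e\subset\Lambda}p_e^{\omega(e)}(1-p_e)^{1-\omega(e)}$, where $\mathfrak N_\Lambda(\omega)$ is the number of open clusters that intersect $\Lambda$; $\mathbb P^{\mathrm w}_\Lambda$ is the case $\eta\equiv1$. For a finite subgraph $\gamma$ of the graph of bonds, $\mathbb P^{\mathrm f}_\gamma$ is the analogous measure on configurations of the bonds of $\gamma$, with all other bonds closed. Let $\hat\beta_c\in[0,\infty]$ be the supremum of the $\beta\geq 0$ for which there are $\nu_0,\nu_1>0$ with $\mathbb P^{\mathrm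 w}_{\Lambda_N}(0\leftrightarrow\mathbb Z^d\setminus\Lambda_N)\le\nu_0e^{-\nu_1N}$ for all $N$, where $\Lambda_N=\{-N,\dots,N\}^d$. Assume $\beta<\hat\beta_c$, and let $\mathbb P$ be the infinite-volume random cluster measure, that is, the probability measure with $\mathbb P(A\mid\mathcal T_\Lambda)(\eta)=\mathbb P^\eta_\Lambda(A)$ for $\mathbb P$-a.e. $\eta$, for all events $A$ and finite $\Lambda$, where $\mathcal T_\Lambda$ is generated by the bonds not contained in $\Lambda$. Put $\xi(x)=-\lim_{k\to\infty}\frac1k\log\mathbb P(0\leftrightarrow[kx])$ for $x\in\mathbb R^d$ (with $[\cdot]$ the componentwise integer part) and $\mathbf K_\xi=\{t\in\mathbb R^d:(t,n)\le\xi(n)\text{ for all }|n|=1\}$. **Irreducible clusters.** Fix $\delta\in(0,\frac13)$. For $t\in\partial\mathbf K_\xi$ let $Y(t)=\{x\in\mathbb Z^d:\xi(x)-(t,x)<3\delta\,\xi(x)\}$ and $Y_0(t)=Y(t)\cup\{0\}$. A cluster is a finite subgraph $\gamma$ of the graph of bonds in which any two vertices are joined by a chain of vertices of $\gamma$ with steps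 of length at most $R$. A vertex $y\in\gamma$ is a cone point of $\gamma$ if $\gamma\subseteq(y-Y_0(t))\cup(y+Y_0(t))$. The cluster $\gamma$ is $t$-backward irreducible if it has a vertex $\mathbf b$ with $\gamma\subseteq\mathbf b-Y_0(t)$ and $\mathbf b$ is its only cone point; it is $t$-forward irreducible if it has a vertex $\mathbf f$ with $\gamma\subseteq\mathbf f+Y_0(t)$ and $\mathbf f$ is its only cone point; it is $t$-irreducible if it has vertices $\mathbf f\ne\mathbf b$ with $\gamma\subseteq(\mathbf f+Y_0(t))\cap(\mathbf b-Y_0(t))$ and $\mathbf f,\mathbf b$ are its only cone points, and then $V(\gamma)=\mathbf b-\mathbf f$. Clusters are considered modulo translations by $\mathbb Z^d$. In a sequence $\gamma^b,\gamma_1,\dots,\gamma_n,\gamma^f$ (backward irreducible, irreducible, forward irreducible) the clusters are translated so that the point $\mathbf b$ of each is the point $\mathbf f$ of the next. Let $\mathcal W_k$ be the event that all edges of $\gamma_k$ are open, and $\mathcal N_k$ the event that all bonds with at least one endpoint in $\gamma_k$ are closed, except the edges of $\gamma_k$, the bonds $(u,\mathbf f)$ with $u\in\mathbf f-Y(t)$,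 and the bonds $(\mathbf b,v)$ with $v\in\mathbf b+Y(t)$. The events $\mathcal N^b,\mathcal N^f$ are defined in the same way from $\gamma^b,\gamma^f$, where the exception at $\mathbf f$ (respectively at $\mathbf b$) is dropped. Define $$g(\gamma_1,\dots,\gamma_n\mid\gamma^b,\gamma^f)=\frac{\mathbb P(\mathcal N^b\mid\mathcal N_1\cdots\mathcal N_n\mathcal N^f)}{\mathbb P(\mathcal N^b)},$$ $$e^{\psi_t(\gamma_1,\dots,\gamma_n\mid\gamma^f)}=e^{(t,V(\gamma_1))}\,\mathbb P^{\mathrm f}_{\gamma_1}(\mathcal W_1)\,\mathbb P(\mathcal N_1\mid\mathcal N_2\cdots\mathcal N_n\mathcal N^f).$$ For strings $\underline\gamma=(\gamma_1,\dots,\gamma_n)$ and $\underline\lambda=(\lambda_1,\dots,\lambda_m)$ put $i(\underline\gamma,\underline\lambda)=\min\{i:\gamma_i\ne\lambda_i\}\wedge n\wedge m$. **Theorem 3.1.** There exist $\theta\in(0,1)$ and constants $\nu_8,\nu_9>0$ such that, uniformly in $t\in\partial\mathbf K_\xi$, in $t$-irreducible clusters $\gamma$, in finite strings $\underline\gamma,\underline\lambda$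 of $t$-irreducible clusters, in $t$-backward irreducible clusters $\gamma^b$ and in pairs $\gamma^f,\tilde\gamma^f$ of $t$-forward irreducible clusters, $$\nu_8\le g(\underline\gamma\mid\gamma^b,\gamma^f)\le\frac1{\nu_8},$$ $$|g(\gamma,\underline\gamma\mid\gamma^b,\gamma^f)-g(\gamma,\underline\lambda\mid\gamma^b,\tilde\gamma^f)|\le\nu_9\,\theta^{i(\underline\gamma,\underline\lambda)},$$ $$|\psi_t(\gamma,\underline\gamma\mid\gamma^f)-\psi_t(\gamma,\underline\lambda\mid\tilde\gamma^f)|\le\nu_9\,\theta^{i(\underline\gamma,\underline\lambda)}.$$ -/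

import Mathlib

namespace FK

open MeasureTheory Filter Set
open scoped Classical Topology

noncomputable section

/-- Sites of the lattice `ℤ^d`. -/
abbrev Site (d : ℕ) : Type := Fin d → ℤ

/-- Euclidean space `ℝ^d`. -/
abbrev Eucl (d : ℕ) : Type := EuclideanSpace ℝ (Fin d)

/-- The inclusion of `ℤ^d` into `ℝ^d`. -/
def toEucl {d : ℕ} (x : Site d) : Eucl d := WithLp.toLp 2 fun i => (x i : ℝ)

/-- Coupling constants: nonnegative, even, of range at most `R`, and positive on nearest
neighbours. -/
structure Coupling (d : ℕ) where
  J : Site d → ℝ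
  R : ℝ
  nonneg : ∀ x, 0 ≤ J x
  symm : ∀ x, J (-x) = J x
  R_pos : 0 < R
  finite_range : ∀ x, R < ‖toEucl x‖ → J x = 0
  nearest_pos : ∀ x, ‖toEucl x‖ = 1 → 0 < J x

variable {d : ℕ}

/-- The graph on `ℤ^d` whose edges are the bonds. -/
def bondGraph (C : Coupling d) : SimpleGraph (Site d) :=
  SimpleGraph.fromRel fun x y => 0 < C.J (y - x)

/-- Bonds: unordered pairs of distinct sites `x`, `y` with `J (y - x) > 0`. -/
abbrev Bond (C : Coupling d) : Type := {e : Sym2 (Site d) // e ∈ (bondGraph C).edgeSet}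

/-- Bond configurations; `true` means open, `false` means closed.  The `σ`-algebra is the product
one. -/
abbrev Config (C : Coupling d) : Type := Bond C → Bool

/-- The coupling constant of an unordered pair of sites. -/
def couplingOf (C : Coupling d) (e : Sym2 (Site d)) : ℝ :=
  Sym2.lift ⟨fun x y => C.J (y - x), fun x y => by
    show C.J (y - x) = C.J (x - y)
    rw [← C.symm (y - x), neg_sub]⟩ e

/-- `p_e = 1 - exp (- 2 β J_e)`. -/
def openProb (C : Coupling d) (β : ℝ) (e : Bond C) : ℝ :=
  1 - Real.exp (-2 * β * couplingOf C e.1)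

/-- The graph of open bonds of a configuration. -/
def openGraph {C : Coupling d} (ω : Config C) : SimpleGraph (Site d) :=
  SimpleGraph.fromEdgeSet {e | ∃ h : e ∈ (bondGraph C).edgeSet, ω ⟨e, h⟩ = true}

/-- The event that `x` and `y` lie in the same open cluster. -/
def connected (C : Coupling d) (x y : Site d) : Set (Config C) :=
  {ω | (openGraph ω).Reachable x y}

/-- The number of open clusters of `ω` that intersect `V`. -/
def clusterCount {C : Coupling d} (V : Finset (Site d)) (ω : Config C) : ℕ :=
  (V.image (openGraph ω).connectedComponentMk).card

/-- The configuration which on `E` is open exactly on `s`, and which equals `η` off `E`. -/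
def patch {C : Coupling d} (E s : Finset (Bond C)) (η : Config C) : Config C :=
  fun e => if e ∈ E then decide (e ∈ s) else η e

/-- The unnormalized random cluster weight of `ω`, for a finite graph with vertex set `V` and set
of bonds `E`. -/
def weight {C : Coupling d} (β q : ℝ) (V : Finset (Site d)) (E : Finset (Bond C))
    (ω : Config C) : ℝ :=
  (∏ e ∈ E, if ω e = true then openProb C β e else 1 - openProb C β e) * q ^ clusterCount V ω

/-- The partition function with boundary condition `η`. -/
def partitionFn {C : Coupling d} (β q : ℝ) (V : Finset (Site d)) (E : Finset (Bond C))
    (η : Config C) : ℝ :=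
  ∑ s ∈ E.powerset, weight β q V E (patch E s η)

/-- The random cluster measure on the finite graph `(V, E)` with boundary condition `η`. -/
def fkMeasure {C : Coupling d} (β q : ℝ) (V : Finset (Site d)) (E : Finset (Bond C))
    (η : Config C) : Measure (Config C) :=
  ∑ s ∈ E.powerset,
    ENNReal.ofReal (weight β q V E (patch E s η) / partitionFn β q V E η) •
      Measure.dirac (patch E s η)

/-- The bonds with both endpoints in `Λ`. -/
def bondsIn (C : Coupling d) (Λ : Finset (Site d)) : Finset (Bond C) :=
  Λ.sym2.subtype fun e => e ∈ (bondGraph C).edgeSet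

/-- The random cluster measure in the finite volume `Λ` with boundary condition `η`. -/
def boxMeasure (C : Coupling d) (β q : ℝ) (Λ : Finset (Site d)) (η : Config C) :
    Measure (Config C) :=
  fkMeasure β q Λ (bondsIn C Λ) η

/-- The `σ`-algebra generated by the states of the bonds that do not have both endpoints in
`Λ`. -/
abbrev outsideSigma (C : Coupling d) (Λ : Finset (Site d)) : MeasurableSpace (Config C) :=
  MeasurableSpace.comap (fun (ω : Config C) (e : {e : Bond C // e ∉ bondsIn C Λ}) => ω e.1)
    MeasurableSpace.pi

/-- Infinite volume random cluster measures: probability measures satisfying the DLR equations. -/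
def IsRandomClusterMeasure (C : Coupling d) (β q : ℝ) (P : Measure (Config C)) : Prop :=
  IsProbabilityMeasure P ∧
    ∀ (Λ : Finset (Site d)) (A : Set (Config C)), MeasurableSet A →
      P[A.indicator (fun _ => (1 : ℝ)) | outsideSigma C Λ]
        =ᵐ[P] fun η => (boxMeasure C β q Λ η).real A

/-- The box `{-N, …, N}^d`. -/
def box (d N : ℕ) : Finset (Site d) := Finset.Icc (fun _ => -(N : ℤ)) (fun _ => (N : ℤ))

/-- The event that the origin is connected to the complement of `Λ`. -/
def connectedOut (C : Coupling d) (Λ : Finset (Site d)) : Set (Config C) :=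
  {ω | ∃ y, y ∉ Λ ∧ ω ∈ connected C 0 y}

/-- Exponential decay, in the size of the box, of the probability that the origin is connected to
the complement of the box under the wired measure of the box. -/
def WiredDecay (C : Coupling d) (β q : ℝ) : Prop :=
  ∃ ν₀ ν₁ : ℝ, 0 < ν₀ ∧ 0 < ν₁ ∧ ∀ N : ℕ,
    (boxMeasure C β q (box d N) (fun _ => true)).real (connectedOut C (box d N))
      ≤ ν₀ * Real.exp (-ν₁ * N)

/-- The supremum of all `β ≥ 0` for which the wired decay holds; it may be infinite. -/
def betaHat (C : Coupling d) (q : ℝ) : EReal :=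
  sSup {b : EReal | ∃ β : ℝ, b = (β : EReal) ∧ 0 ≤ β ∧ WiredDecay C β q}

/-- The inverse correlation length `ξ(x) = - lim_k k⁻¹ log P(0 ↔ [k x])`. -/
def invCorrLength {C : Coupling d} (P : Measure (Config C)) (x : Eucl d) : ℝ :=
  limUnder atTop fun k : ℕ =>
    -(1 / (k : ℝ)) * Real.log (P.real (connected C 0 fun i => ⌊(k : ℝ) * x i⌋))

/-- The Wulff shape of `ξ`. -/
def wulffShape (ξ : Eucl d → ℝ) : Set (Eucl d) :=
  {t | ∀ n : Eucl d, ‖n‖ = 1 → inner ℝ t n ≤ ξ n}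

/-- The surcharge function `ξ(y) - (t, y)`. -/
def surcharge (ξ : Eucl d → ℝ) (t y : Eucl d) : ℝ := ξ y - inner ℝ t y

/-- The open forward cone `{x ∈ ℤ^d : 𝔰_t(x) < δ ξ(x)}`; it does not contain its apex. -/
def forwardCone (ξ : Eucl d → ℝ) (t : Eucl d) (δ : ℝ) : Set (Site d) :=
  {x | surcharge ξ t (toEucl x) < δ * ξ (toEucl x)}

/-- Finite subgraphs of the bond graph. -/
@[ext]
structure Cluster (C : Coupling d) where
  verts : Finset (Site d)
  bonds : Finset (Bond C)
  mem_verts : ∀ e ∈ bonds, ∀ x ∈ e.1, x ∈ verts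

/-- Any two vertices of the cluster are joined by a chain of vertices of the cluster with steps of
length at most `R`.  Every connected subgraph of the bond graph has this property. -/
def Cluster.RConnected {C : Coupling d} (γ : Cluster C) : Prop :=
  ∀ x ∈ γ.verts, ∀ y ∈ γ.verts,
    Relation.ReflTransGen (fun u v => v ∈ γ.verts ∧ ‖toEucl (v - u)‖ ≤ C.R) x y

/-- `y` is a cone point of `γ`: the cluster is contained in the union of the backward and the
forward cones at `y` of opening `3δ`, the apex `y` being included. -/
def IsConePoint {C : Coupling d} (ξ : Eucl d → ℝ) (t : Eucl d) (δ : ℝ) (γ : Cluster C)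
    (y : Site d) : Prop :=
  y ∈ γ.verts ∧ ∀ x ∈ γ.verts,
    y - x ∈ insert 0 (forwardCone ξ t (3 * δ)) ∨ x - y ∈ insert 0 (forwardCone ξ t (3 * δ))

/-- `γ` is backward irreducible with end point `b`. -/
def IsBackwardIrreducible {C : Coupling d} (ξ : Eucl d → ℝ) (t : Eucl d) (δ : ℝ) (γ : Cluster C)
    (b : Site d) : Prop :=
  γ.RConnected ∧ b ∈ γ.verts ∧
    (∀ x ∈ γ.verts, b - x ∈ insert 0 (forwardCone ξ t (3 * δ))) ∧
    ∀ y, IsConePoint ξ t δ γ y ↔ y = b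

/-- `γ` is forward irreducible with starting point `f`. -/
def IsForwardIrreducible {C : Coupling d} (ξ : Eucl d → ℝ) (t : Eucl d) (δ : ℝ) (γ : Cluster C)
    (f : Site d) : Prop :=
  γ.RConnected ∧ f ∈ γ.verts ∧
    (∀ x ∈ γ.verts, x - f ∈ insert 0 (forwardCone ξ t (3 * δ))) ∧
    ∀ y, IsConePoint ξ t δ γ y ↔ y = f

/-- `γ` is irreducible with starting point `f` and end point `b`. -/
def IsIrreducible {C : Coupling d} (ξ : Eucl d → ℝ) (t : Eucl d) (δ : ℝ) (γ : Cluster C)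
    (f b : Site d) : Prop :=
  γ.RConnected ∧ f ∈ γ.verts ∧ b ∈ γ.verts ∧ f ≠ b ∧
    (∀ x ∈ γ.verts, b - x ∈ insert 0 (forwardCone ξ t (3 * δ))) ∧
    (∀ x ∈ γ.verts, x - f ∈ insert 0 (forwardCone ξ t (3 * δ))) ∧
    ∀ y, IsConePoint ξ t δ γ y ↔ y = f ∨ y = b

/-- Backward irreducible clusters modulo shifts: the representative ends at the origin. -/
structure BackwardCluster (C : Coupling d) (ξ : Eucl d → ℝ) (t : Eucl d) (δ : ℝ) where
  cluster : Cluster C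
  irred : IsBackwardIrreducible ξ t δ cluster 0

/-- Forward irreducible clusters modulo shifts: the representative starts at the origin. -/
structure ForwardCluster (C : Coupling d) (ξ : Eucl d → ℝ) (t : Eucl d) (δ : ℝ) where
  cluster : Cluster C
  irred : IsForwardIrreducible ξ t δ cluster 0

/-- Irreducible clusters modulo shifts: the representative starts at the origin.  Its end point,
which the cluster determines, is thus the displacement along the cluster. -/
structure IrredCluster (C : Coupling d) (ξ : Eucl d → ℝ) (t : Eucl d) (δ : ℝ) where
  cluster : Cluster C
  displacement : Site d
  irred : IsIrreducible ξ t δ cluster 0 displacement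

/-- The bonds with at least one endpoint in `γ` which are not bonds of `γ`. -/
def Cluster.boundaryBonds {C : Coupling d} (γ : Cluster C) : Set (Sym2 (Site d)) :=
  {e | ∃ h : e ∈ (bondGraph C).edgeSet, (∃ u ∈ γ.verts, u ∈ e) ∧ ⟨e, h⟩ ∉ γ.bonds}

/-- Pairs `(u, f)` with `u` in the backward cone at `f`. -/
def pairsBehind (ξ : Eucl d → ℝ) (t : Eucl d) (δ : ℝ) (f : Site d) : Set (Sym2 (Site d)) :=
  {e | ∃ u, f - u ∈ forwardCone ξ t (3 * δ) ∧ e = s(u, f)}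

/-- Pairs `(b, v)` with `v` in the forward cone at `b`. -/
def pairsAhead (ξ : Eucl d → ℝ) (t : Eucl d) (δ : ℝ) (b : Site d) : Set (Sym2 (Site d)) :=
  {e | ∃ v, v - b ∈ forwardCone ξ t (3 * δ) ∧ e = s(b, v)}

/-- The bonds that the event `𝒩` of an irreducible cluster closes. -/
def IrredCluster.closedBonds {C : Coupling d} {ξ : Eucl d → ℝ} {t : Eucl d} {δ : ℝ}
    (γ : IrredCluster C ξ t δ) : Set (Sym2 (Site d)) :=
  γ.cluster.boundaryBonds \ (pairsBehind ξ t δ 0 ∪ pairsAhead ξ t δ γ.displacement)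

/-- The bonds that the event `𝒩` of a backward irreducible cluster closes. -/
def BackwardCluster.closedBonds {C : Coupling d} {ξ : Eucl d → ℝ} {t : Eucl d} {δ : ℝ}
    (γ : BackwardCluster C ξ t δ) : Set (Sym2 (Site d)) :=
  γ.cluster.boundaryBonds \ pairsAhead ξ t δ 0

/-- The bonds that the event `𝒩` of a forward irreducible cluster closes. -/
def ForwardCluster.closedBonds {C : Coupling d} {ξ : Eucl d → ℝ} {t : Eucl d} {δ : ℝ}
    (γ : ForwardCluster C ξ t δ) : Set (Sym2 (Site d)) :=
  γ.cluster.boundaryBonds \ pairsBehind ξ t δ 0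

/-- Translation by `v` of a set of pairs of sites. -/
def shift (v : Site d) (A : Set (Sym2 (Site d))) : Set (Sym2 (Site d)) :=
  Sym2.map (fun x => v + x) '' A

/-- The event that all bonds of `A` are closed. -/
def allClosed (C : Coupling d) (A : Set (Sym2 (Site d))) : Set (Config C) :=
  {ω | ∀ e : Bond C, e.1 ∈ A → ω e = false}

/-- The event that all bonds of `γ` are open. -/
def Cluster.allOpen {C : Coupling d} (γ : Cluster C) : Set (Config C) :=
  {ω | ∀ e ∈ γ.bonds, ω e = true}

/-- The event `𝒩₁ ⋯ 𝒩ₙ 𝒩ᶠ` for the concatenation of `γ₁, …, γₙ, γᶠ`, where the first of these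
clusters starts at `v` and each further one starts at the end point of its predecessor. -/
def chainClosed {C : Coupling d} {ξ : Eucl d → ℝ} {t : Eucl d} {δ : ℝ} (v : Site d) :
    List (IrredCluster C ξ t δ) → ForwardCluster C ξ t δ → Set (Config C)
  | [], γf => allClosed C (shift v γf.closedBonds)
  | γ :: γs, γf =>
      allClosed C (shift v γ.closedBonds) ∩ chainClosed (v + γ.displacement) γs γf

/-- The conditional probability `P(A | B)`. -/
def condProb {C : Coupling d} (P : Measure (Config C)) (A B : Set (Config C)) : ℝ :=
  P.real (A ∩ B) / P.real B

/-- The boundary function `g(γ₁, …, γₙ | γᵇ, γᶠ)`. -/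
def g {C : Coupling d} {ξ : Eucl d → ℝ} {t : Eucl d} {δ : ℝ} (P : Measure (Config C))
    (γs : List (IrredCluster C ξ t δ)) (γb : BackwardCluster C ξ t δ)
    (γf : ForwardCluster C ξ t δ) : ℝ :=
  condProb P (allClosed C γb.closedBonds) (chainClosed 0 γs γf) /
    P.real (allClosed C γb.closedBonds)

/-- The random cluster measure with free boundary condition on a finite subgraph. -/
def freeMeasure {C : Coupling d} (β q : ℝ) (γ : Cluster C) : Measure (Config C) :=
  fkMeasure β q γ.verts γ.bonds fun _ => false

/-- The potential `ψ_t(γ, γ₁, …, γₙ | γᶠ)`, the logarithm of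
`exp (t, V(γ)) P_γᶠʳᵉᵉ(𝒲) P(𝒩 | 𝒩₁ ⋯ 𝒩ₙ 𝒩ᶠ)`. -/
def psi {C : Coupling d} {ξ : Eucl d → ℝ} {t : Eucl d} {δ : ℝ} (β q : ℝ)
    (P : Measure (Config C)) (γ : IrredCluster C ξ t δ) (γs : List (IrredCluster C ξ t δ))
    (γf : ForwardCluster C ξ t δ) : ℝ :=
  Real.log (Real.exp (inner ℝ t (toEucl γ.displacement)) *
    (freeMeasure β q γ.cluster).real γ.cluster.allOpen *
    condProb P (allClosed C γ.closedBonds) (chainClosed γ.displacement γs γf))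

/-- `min {i : γᵢ ≠ λᵢ} ∧ n ∧ m` for strings of lengths `n` and `m`, with indices starting
at `1`. -/
def firstDisagreement {α : Type*} (l l' : List α) : ℕ :=
  sInf ({i | 1 ≤ i ∧ l[i - 1]? ≠ l'[i - 1]?} ∪ {l.length, l'.length})

end

end FK

namespace FK

open MeasureTheory Filter Set
open scoped Classical Topology

noncomputable section

variable {d : ℕ}

/-! Every event 𝒩 closes a finite set of bonds. Let L(S) be the logarithm of the probability that
all bonds of S are closed (`logClosed`). If D belongs to the backward cluster and T to everything
that follows, then g = exp(L(D ∪ T) - L(T) - L(D)). If D belongs to γ and the prefactor in ψ is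
nonzero, then ψ is a term depending on γ alone plus L(D ∪ T) - L(T). Two continuations with a common
initial string have T = S ∪ E and T' = S ∪ E', where S is shared and E, E' lie far ahead. All three
claims therefore follow from bounds on the mixed second difference L(D ∪ S ∪ E) - L(S ∪ E) - L(D ∪
S) + L(S), uniform in the background S (`exists_cone_mixing`).

This difference is nonnegative by the FKG lattice condition. For the upper bound, close the bonds of
D one at a time. For a single bond e, explore the open clusters of its endpoints inside a box away
from E. If they stay in the box, what has been explored is a region V sealed by closed bonds. Given
the seal, the inside of V is independent of the outside, so the ratio of the probabilities of a
pattern in V with and without closing E does not depend on the pattern. For the pattern with all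
bonds closed, the lattice condition bounds this ratio as needed (`isolatedPattern_inter_le`). Hence
closing E raises the conditional probability that e is closed by at most the probability that an
endpoint of e is connected out of the box (`closedOn_insert_div_le`). This is exponentially small,
and since P(e closed) is bounded below, the bound passes to logarithms.

It remains to sum over D. The cluster behind D lies in a backward cone at v, where the slope (t, v -
u) is at least c‖u - v‖, while E lies at slope at least cn beyond v. As slopes are Lipschitz, a bond
of D at distance r from v is at distance of order r + n from E, up to the range R. The sum over D is
thus of order exp(-κn), however large D is.

The inputs come from exponential decay. Domination by wired measures at a larger β gives decay under
P uniformly in the starting point. Decay shows that P is the limit of free measures in boxes, whence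
infinite-volume FKG and translation invariance. It also gives two-sided linear bounds on ξ, which
make the cones strictly transversal to the slope and bound t. -/

/-! ### Counting open clusters: supermodularity. -/

theorem card_image_eq_card_image_ker {α β : Type*} (V : Finset α) (f : α → β) :
    (V.image f).card = (V.image fun x => V.filter fun y => f x = f y).card := by
  have : (V.image fun x => V.filter fun y => f x = f y)
      = (V.image f).image fun c => V.filter fun y => c = f y := by
    rw [Finset.image_image]; rfl
  rw [this]
  refine (Finset.card_image_of_injOn fun a ha b _ hab => ?_).symm
  obtain ⟨x, hx, rfl⟩ := Finset.mem_image.1 ha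
  have : x ∈ V.filter fun y => f x = f y := by simpa using hx
  rw [show (V.filter fun y => f x = f y) = _ from hab] at this
  exact (Finset.mem_filter.1 this).2.symm

/-- The number of values of f on V depends only on which points of V it identifies. This allows
clusters of different graphs to be counted against each other. -/
theorem card_image_eq_of_ker {α β β' : Type*} (V : Finset α) (f : α → β) (g : α → β')
    (h : ∀ x ∈ V, ∀ y ∈ V, f x = f y ↔ g x = g y) : (V.image f).card = (V.image g).card := by
  rw [card_image_eq_card_image_ker V f, card_image_eq_card_image_ker V g]
  congr 1
  refine Finset.image_congr fun x hx => ?_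
  exact Finset.filter_congr fun y hy => h x hx y hy

/-- Reachability after adding one edge. -/
theorem reachable_sup_edge_iff {α : Type*} (G : SimpleGraph α) (x y a b : α) :
    (G ⊔ SimpleGraph.edge x y).Reachable a b ↔ G.Reachable a b ∨
      (G.Reachable a x ∧ G.Reachable y b) ∨ (G.Reachable a y ∧ G.Reachable x b) := by
  constructor
  · rintro ⟨p⟩
    induction p with
    | nil => exact Or.inl (SimpleGraph.Reachable.refl _)
    | @cons u v w h p ih =>
      rw [SimpleGraph.sup_adj, SimpleGraph.edge_adj] at h
      rcases h with h | ⟨⟨rfl, rfl⟩ | ⟨rfl, rfl⟩, -⟩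
      · have h := h.reachable
        rcases ih with ih | ⟨ih, ih'⟩ | ⟨ih, ih'⟩
        · exact Or.inl (h.trans ih)
        · exact Or.inr (Or.inl ⟨h.trans ih, ih'⟩)
        · exact Or.inr (Or.inr ⟨h.trans ih, ih'⟩)
      · rcases ih with ih | ⟨ih, ih'⟩ | ⟨ih, ih'⟩
        · exact Or.inr (Or.inl ⟨.refl _, ih⟩)
        · exact Or.inr (Or.inl ⟨.refl _, ih'⟩)
        · exact Or.inl ih'
      · rcases ih with ih | ⟨ih, ih'⟩ | ⟨ih, ih'⟩
        · exact Or.inr (Or.inr ⟨.refl _, ih⟩)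
        · exact Or.inl ih'
        · exact Or.inr (Or.inr ⟨.refl _, ih'⟩)
  · have hxy : (G ⊔ SimpleGraph.edge x y).Reachable x y := by
      by_cases h : x = y
      · rw [h]
      · refine SimpleGraph.Adj.reachable ?_
        rw [SimpleGraph.sup_adj, SimpleGraph.edge_adj]
        exact Or.inr ⟨Or.inl ⟨rfl, rfl⟩, h⟩
    rintro (h | ⟨h, h'⟩ | ⟨h, h'⟩)
    · exact h.mono le_sup_left
    · exact (h.mono le_sup_left).trans (hxy.trans (h'.mono le_sup_left))
    · exact (h.mono le_sup_left).trans (hxy.symm.trans (h'.mono le_sup_left))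

/-- Adding an edge between two vertices of `V` merges at most two of the components that
intersect `V`. -/
theorem card_components_sup_edge {α : Type*} (G : SimpleGraph α) (V : Finset α) {x y : α}
    (hx : x ∈ V) (hy : y ∈ V) :
    (V.image (G ⊔ SimpleGraph.edge x y).connectedComponentMk).card
      + (if G.Reachable x y then 0 else 1) = (V.image G.connectedComponentMk).card := by
  split_ifs with h
  · rw [add_zero]
    refine card_image_eq_of_ker V _ _ fun a _ b _ => ?_
    rw [SimpleGraph.ConnectedComponent.eq, SimpleGraph.ConnectedComponent.eq,
      reachable_sup_edge_iff]
    constructor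
    · rintro (h1 | ⟨h1, h2⟩ | ⟨h1, h2⟩)
      · exact h1
      · exact h1.trans (h.trans h2)
      · exact h1.trans (h.symm.trans h2)
    · exact Or.inl
  · set φ : G.ConnectedComponent → (G ⊔ SimpleGraph.edge x y).ConnectedComponent :=
      SimpleGraph.ConnectedComponent.map (SimpleGraph.Hom.ofLE le_sup_left) with hφ
    have hφm : ∀ a, φ (G.connectedComponentMk a)
        = (G ⊔ SimpleGraph.edge x y).connectedComponentMk a := fun a => rfl
    have hne : G.connectedComponentMk x ≠ G.connectedComponentMk y := by
      rwa [Ne, SimpleGraph.ConnectedComponent.eq]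
    have hyI : G.connectedComponentMk y ∈ V.image G.connectedComponentMk :=
      Finset.mem_image_of_mem _ hy
    -- The class of y is absorbed by that of x. The remaining old classes are in bijection with the
    -- new ones.
    have h1 : V.image (G ⊔ SimpleGraph.edge x y).connectedComponentMk
        = ((V.image G.connectedComponentMk).erase (G.connectedComponentMk y)).image φ := by
      ext c
      constructor
      · intro hc
        obtain ⟨a, ha, rfl⟩ := Finset.mem_image.1 hc
        by_cases hay : G.connectedComponentMk a = G.connectedComponentMk y
        · refine Finset.mem_image.2 ⟨G.connectedComponentMk x,
            Finset.mem_erase.2 ⟨hne, Finset.mem_image_of_mem _ hx⟩, ?_⟩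
          rw [hφm, SimpleGraph.ConnectedComponent.eq, reachable_sup_edge_iff]
          rw [SimpleGraph.ConnectedComponent.eq] at hay
          exact Or.inr (Or.inl ⟨.refl _, hay.symm⟩)
        · exact Finset.mem_image.2 ⟨_, Finset.mem_erase.2 ⟨hay, Finset.mem_image_of_mem _ ha⟩,
            hφm a⟩
      · intro hc
        obtain ⟨c', hc', rfl⟩ := Finset.mem_image.1 hc
        obtain ⟨a, ha, rfl⟩ := Finset.mem_image.1 (Finset.mem_of_mem_erase hc')
        exact Finset.mem_image.2 ⟨a, ha, (hφm a).symm⟩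
    rw [h1, Finset.card_image_of_injOn, Finset.card_erase_add_one hyI]
    intro c hc c' hc' hcc
    have hc := Finset.mem_coe.1 hc
    have hc' := Finset.mem_coe.1 hc'
    obtain ⟨a, ha, rfl⟩ := Finset.mem_image.1 (Finset.mem_of_mem_erase hc)
    obtain ⟨b, hb, rfl⟩ := Finset.mem_image.1 (Finset.mem_of_mem_erase hc')
    have ha' := Finset.ne_of_mem_erase hc
    have hb' := Finset.ne_of_mem_erase hc'
    rw [Ne, SimpleGraph.ConnectedComponent.eq] at ha' hb'
    rw [hφm, hφm, SimpleGraph.ConnectedComponent.eq, reachable_sup_edge_iff] at hcc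
    rw [SimpleGraph.ConnectedComponent.eq]
    rcases hcc with h1 | ⟨h1, h2⟩ | ⟨h1, h2⟩
    · exact h1
    · exact absurd h2.symm hb'
    · exact absurd h1 ha'

theorem openGraph_adj {C : Coupling d} {ω : Config C} {x y : Site d} :
    (openGraph ω).Adj x y ↔ ∃ h : s(x, y) ∈ (bondGraph C).edgeSet, ω ⟨s(x, y), h⟩ = true := by
  rw [openGraph, SimpleGraph.fromEdgeSet_adj]
  constructor
  · rintro ⟨h, -⟩
    exact h
  · rintro ⟨h, h'⟩
    exact ⟨⟨h, h'⟩, ((bondGraph C).mem_edgeSet.1 h).ne⟩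

theorem openGraph_mono {C : Coupling d} {ω ω' : Config C} (h : ω ≤ ω') :
    openGraph ω ≤ openGraph ω' := by
  intro x y hxy
  obtain ⟨he, ho⟩ := openGraph_adj.1 hxy
  refine openGraph_adj.2 ⟨he, ?_⟩
  have := h ⟨_, he⟩
  rw [ho] at this
  exact this (by decide)

theorem openGraph_update {C : Coupling d} (ω : Config C) {x y : Site d}
    (h : s(x, y) ∈ (bondGraph C).edgeSet) :
    openGraph (Function.update ω ⟨s(x, y), h⟩ true) = openGraph ω ⊔ SimpleGraph.edge x y := by
  ext a b
  rw [SimpleGraph.sup_adj, openGraph_adj, openGraph_adj, SimpleGraph.edge_adj]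
  constructor
  · rintro ⟨he, ho⟩
    by_cases hab : s(a, b) = s(x, y)
    · right
      refine ⟨?_, ((bondGraph C).mem_edgeSet.1 he).ne⟩
      simpa using hab
    · left
      refine ⟨he, ?_⟩
      rwa [Function.update_of_ne] at ho
      exact fun h' => hab (congrArg Subtype.val h')
  · rintro (⟨he, ho⟩ | ⟨hab, hne⟩)
    · refine ⟨he, ?_⟩
      by_cases h' : (⟨s(a, b), he⟩ : Bond C) = ⟨s(x, y), h⟩
      · rw [h', Function.update_self]
      · rwa [Function.update_of_ne h']
    · have hab : s(a, b) = s(x, y) := by simpa using hab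
      refine ⟨hab ▸ h, ?_⟩
      have : (⟨s(a, b), hab ▸ h⟩ : Bond C) = ⟨s(x, y), h⟩ := Subtype.ext hab
      rw [this, Function.update_self]

/-- Opening one bond decreases the number of clusters by less in a larger configuration. -/
theorem clusterCount_update_add_le {C : Coupling d} (V : Finset (Site d)) {α β : Config C}
    (h : α ≤ β) (e : Bond C) (he : ∀ x ∈ e.1, x ∈ V) :
    clusterCount V (Function.update α e true) + clusterCount V β
      ≤ clusterCount V α + clusterCount V (Function.update β e true) := by
  obtain ⟨e, hE⟩ := e
  induction e with
  | _ x y =>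
    have hx : x ∈ V := he x (by simp)
    have hy : y ∈ V := he y (by simp)
    have h1 := card_components_sup_edge (openGraph α) V hx hy
    have h2 := card_components_sup_edge (openGraph β) V hx hy
    rw [clusterCount, clusterCount, clusterCount, clusterCount, openGraph_update,
      openGraph_update]
    -- More open bonds make it likelier that the new bond lies within a single cluster and merges
    -- nothing.
    have h3 : (if (openGraph β).Reachable x y then 0 else 1)
        ≤ (if (openGraph α).Reachable x y then 0 else 1) := by
      by_cases h' : (openGraph α).Reachable x y
      · simp [h', h'.mono (openGraph_mono h)]
      · rw [if_neg h']; split_ifs <;> simp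
    omega

/-- The configuration `ω` with the bonds of `F` opened. -/
def openOn {C : Coupling d} (F : Finset (Bond C)) (ω : Config C) : Config C :=
  fun e => if e ∈ F then true else ω e

/-- Iterates the one-bond inequality. The order α ≤ β survives because the same bonds are opened in
both configurations. -/
theorem clusterCount_openOn_add_le {C : Coupling d} (V : Finset (Site d)) {α β : Config C}
    (h : α ≤ β) (F : Finset (Bond C)) (hF : ∀ e ∈ F, ∀ x ∈ e.1, x ∈ V) :
    clusterCount V (openOn F α) + clusterCount V β
      ≤ clusterCount V α + clusterCount V (openOn F β) := by
  induction F using Finset.induction_on with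
  | empty =>
    have h0 : ∀ γ : Config C, openOn ∅ γ = γ := fun γ => by funext e; simp [openOn]
    rw [h0, h0]
  | insert e F he ih =>
    have hins : ∀ γ : Config C, openOn (insert e F) γ = Function.update (openOn F γ) e true := by
      intro γ
      funext e'
      by_cases h' : e' = e
      · subst h'; simp [openOn]
      · simp [openOn, h']
    have hle : openOn F α ≤ openOn F β := by
      intro e'
      by_cases h' : e' ∈ F
      · simp [openOn, h']
      · simpa [openOn, h'] using h e'
    have h1 := ih fun e' he' => hF e' (Finset.mem_insert_of_mem he')
    have h2 := clusterCount_update_add_le V hle e (hF e (Finset.mem_insert_self _ _))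
    rw [hins, hins]
    omega

/-- Supermodularity of the number of clusters. -/
theorem clusterCount_patch_add_le {C : Coupling d} (V : Finset (Site d)) (E : Finset (Bond C))
    (hE : ∀ e ∈ E, ∀ x ∈ e.1, x ∈ V) {η η' : Config C} (h : η ≤ η') (a b : Finset (Bond C)) :
    clusterCount V (patch E a η) + clusterCount V (patch E b η')
      ≤ clusterCount V (patch E (a ∩ b) η) + clusterCount V (patch E (a ∪ b) η') := by
  have hle : patch E (a ∩ b) η ≤ patch E b η' := by
    intro e
    by_cases he : e ∈ E
    · by_cases hb : e ∈ b <;> simp [patch, he, hb]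
    · simpa [patch, he] using h e
  -- Opening the bonds of E ∩ a leads from a ∩ b to a and from b to a ∪ b.
  have key := clusterCount_openOn_add_le V hle (E ∩ a)
    fun e he => hE e (Finset.mem_inter.1 he).1
  have h1 : openOn (E ∩ a) (patch E (a ∩ b) η) = patch E a η := by
    funext e
    by_cases he : e ∈ E <;> by_cases ha : e ∈ a <;> simp [openOn, patch, he, ha]
  have h2 : openOn (E ∩ a) (patch E b η') = patch E (a ∪ b) η' := by
    funext e
    by_cases he : e ∈ E <;> by_cases ha : e ∈ a <;> simp [openOn, patch, he, ha]
  rwa [h1, h2] at key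

/-! ### Finite-volume random cluster measures: positivity and FKG. -/

theorem couplingOf_pos {C : Coupling d} (e : Bond C) : 0 < couplingOf C e.1 := by
  obtain ⟨e, he⟩ := e
  induction e with
  | _ x y =>
    have h := (SimpleGraph.mem_edgeSet _).1 he
    rw [bondGraph, SimpleGraph.fromRel_adj] at h
    change 0 < C.J (y - x)
    rcases h.2 with h | h
    · exact h
    · rwa [← C.symm, neg_sub]

theorem openProb_pos {C : Coupling d} {β : ℝ} (hβ : 0 < β) (e : Bond C) :
    0 < openProb C β e := by
  have := mul_pos hβ (couplingOf_pos e)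
  rw [openProb, sub_pos, Real.exp_lt_one_iff]
  nlinarith

theorem openProb_nonneg {C : Coupling d} {β : ℝ} (hβ : 0 ≤ β) (e : Bond C) :
    0 ≤ openProb C β e := by
  have := mul_nonneg hβ (couplingOf_pos e).le
  rw [openProb, sub_nonneg, Real.exp_le_one_iff]
  nlinarith

theorem openProb_lt_one {C : Coupling d} {β : ℝ} (e : Bond C) : openProb C β e < 1 := by
  rw [openProb]
  linarith [Real.exp_pos (-2 * β * couplingOf C e.1)]

theorem openProb_mono {C : Coupling d} {β β' : ℝ} (h : β ≤ β') (e : Bond C) :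
    openProb C β e ≤ openProb C β' e := by
  rw [openProb, openProb]
  have := mul_le_mul_of_nonneg_right h (couplingOf_pos e).le
  have : Real.exp (-2 * β' * couplingOf C e.1) ≤ Real.exp (-2 * β * couplingOf C e.1) :=
    Real.exp_le_exp.2 (by linarith)
  linarith

section Weights

variable {C : Coupling d} {β β' q : ℝ} {V : Finset (Site d)} {E : Finset (Bond C)}
  {η η' : Config C}

theorem weight_nonneg (hβ : 0 ≤ β) (hq : 1 ≤ q) (ω : Config C) : 0 ≤ weight β q V E ω := by
  refine mul_nonneg (Finset.prod_nonneg fun e _ => ?_) (by positivity)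
  split_ifs
  · exact openProb_nonneg hβ e
  · linarith [openProb_lt_one (β := β) e]

theorem weight_pos (hβ : 0 < β) (hq : 1 ≤ q) (ω : Config C) : 0 < weight β q V E ω := by
  refine mul_pos (Finset.prod_pos fun e _ => ?_) (by positivity)
  split_ifs
  · exact openProb_pos hβ e
  · linarith [openProb_lt_one (β := β) e]

/-- At β = 0 an open bond has weight zero, so for β ≥ 0 the positivity of the partition function
rests on the configuration with every bond of E closed. -/
theorem weight_patch_empty_pos (hq : 1 ≤ q) : 0 < weight β q V E (patch E ∅ η) := by
  refine mul_pos (Finset.prod_pos fun e he => ?_) (by positivity)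
  have : patch E ∅ η e = false := by simp [patch, he]
  rw [if_neg (by simp [this])]
  linarith [openProb_lt_one (β := β) e]

theorem partitionFn_pos (hβ : 0 ≤ β) (hq : 1 ≤ q) : 0 < partitionFn β q V E η :=
  Finset.sum_pos' (fun _ _ => weight_nonneg hβ hq _)
    ⟨∅, Finset.empty_mem_powerset _, weight_patch_empty_pos hq⟩

/-- The Holley condition with β and η varied together, so that one application of the four functions
theorem gives both FKG and the comparison in β and in the boundary condition. -/
theorem weight_patch_mul_le (hβ : 0 ≤ β) (hββ : β ≤ β') (hq : 1 ≤ q)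
    (hE : ∀ e ∈ E, ∀ x ∈ e.1, x ∈ V) (h : η ≤ η') (a b : Finset (Bond C)) :
    weight β q V E (patch E a η) * weight β' q V E (patch E b η')
      ≤ weight β q V E (patch E (a ∩ b) η) * weight β' q V E (patch E (a ∪ b) η') := by
  have hβ' := hβ.trans hββ
  simp only [weight]
  refine (mul_mul_mul_comm _ _ _ _).le.trans (le_trans ?_ (mul_mul_mul_comm _ _ _ _).ge)
  rw [← Finset.prod_mul_distrib, ← Finset.prod_mul_distrib, ← pow_add, ← pow_add]
  have hnn : ∀ (γ γ' : Config C), ∀ e ∈ E,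
      0 ≤ (if γ e = true then openProb C β e else 1 - openProb C β e)
        * (if γ' e = true then openProb C β' e else 1 - openProb C β' e) := by
    intro γ γ' e _
    have h1 := openProb_nonneg hβ e
    have h2 := openProb_nonneg hβ' e
    have h3 := openProb_lt_one (β := β) e
    have h4 := openProb_lt_one (β := β') e
    refine mul_nonneg ?_ ?_ <;> split_ifs <;> linarith
  refine mul_le_mul (Finset.prod_le_prod (hnn _ _) fun e he => ?_)
    (pow_le_pow_right₀ hq (clusterCount_patch_add_le V E hE h a b)) (by positivity)
    (Finset.prod_nonneg (hnn _ _))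
  -- The two sides can differ only for a bond in a but not in b. There p(1 - p') ≤ (1 - p)p' amounts
  -- to p ≤ p'.
  have h1 := openProb_mono hββ e
  by_cases ha : e ∈ a <;> by_cases hb : e ∈ b <;> simp [patch, he, ha, hb]
  nlinarith

theorem fkMeasure_real (hβ : 0 ≤ β) (hq : 1 ≤ q) (A : Set (Config C)) :
    (fkMeasure β q V E η).real A
      = (∑ s ∈ E.powerset, if patch E s η ∈ A then weight β q V E (patch E s η) else 0)
        / partitionFn β q V E η := by
  rw [Measure.real, fkMeasure, Measure.finsetSum_apply, ENNReal.toReal_sum, Finset.sum_div]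
  · refine Finset.sum_congr rfl fun s _ => ?_
    rw [Measure.smul_apply, Measure.dirac_apply, smul_eq_mul, ENNReal.toReal_mul,
      ENNReal.toReal_ofReal (div_nonneg (weight_nonneg hβ hq _) (partitionFn_pos hβ hq).le)]
    by_cases h : patch E s η ∈ A <;> simp [h]
  · intro s _
    rw [Measure.smul_apply, Measure.dirac_apply, smul_eq_mul]
    refine ENNReal.mul_ne_top ENNReal.ofReal_ne_top ?_
    by_cases h : patch E s η ∈ A <;> simp [h]

theorem fkMeasure_real_pos (hβ : 0 < β) (hq : 1 ≤ q) {A : Set (Config C)} {s : Finset (Bond C)}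
    (hs : s ⊆ E) (h : patch E s η ∈ A) : 0 < (fkMeasure β q V E η).real A := by
  rw [fkMeasure_real hβ.le hq]
  refine div_pos (Finset.sum_pos' (fun s _ => ?_)
    ⟨s, Finset.mem_powerset.2 hs, ?_⟩) (partitionFn_pos hβ.le hq)
  · split_ifs
    exacts [weight_nonneg hβ.le hq _, le_rfl]
  · rw [if_pos h]
    exact weight_pos hβ hq _

theorem fkMeasure_real_univ (hβ : 0 ≤ β) (hq : 1 ≤ q) :
    (fkMeasure β q V E η).real univ = 1 := by
  rw [fkMeasure_real hβ hq]
  simp only [mem_univ, if_true]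
  exact div_self (partitionFn_pos hβ hq).ne'

theorem isProbabilityMeasure_fkMeasure (hβ : 0 ≤ β) (hq : 1 ≤ q) :
    IsProbabilityMeasure (fkMeasure β q V E η) :=
  ⟨by
    have h := fkMeasure_real_univ (V := V) (E := E) (η := η) hβ hq
    rwa [Measure.real, ENNReal.toReal_eq_one_iff] at h⟩

/-- The four functions theorem for random cluster measures and indicator functions. -/
theorem fkMeasure_four_events (hβ : 0 ≤ β) (hββ : β ≤ β') (hq : 1 ≤ q)
    (hE : ∀ e ∈ E, ∀ x ∈ e.1, x ∈ V) (h : η ≤ η') {A₁ A₂ A₃ A₄ : Set (Config C)}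
    (hA : ∀ ω ∈ A₁, ∀ ω' ∈ A₂, ω ⊓ ω' ∈ A₃ ∧ ω ⊔ ω' ∈ A₄) :
    (fkMeasure β q V E η).real A₁ * (fkMeasure β' q V E η').real A₂
      ≤ (fkMeasure β q V E η).real A₃ * (fkMeasure β' q V E η').real A₄ := by
  have hβ' := hβ.trans hββ
  rw [fkMeasure_real hβ hq, fkMeasure_real hβ' hq, fkMeasure_real hβ hq, fkMeasure_real hβ' hq,
    div_mul_div_comm, div_mul_div_comm]
  refine div_le_div_of_nonneg_right ?_
    (mul_pos (partitionFn_pos hβ hq) (partitionFn_pos hβ' hq)).le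
  have hn : ∀ (β : ℝ) (η : Config C) (A : Set (Config C)), 0 ≤ β →
      (0 : Finset (Bond C) → ℝ) ≤
        fun s => if patch E s η ∈ A then weight β q V E (patch E s η) else 0 := by
    intro β η A hβ s
    change (0 : ℝ) ≤ _
    beta_reduce
    split_ifs
    exacts [weight_nonneg hβ hq _, le_rfl]
  have key := Finset.four_functions_theorem E (hn β η A₁ hβ) (hn β' η' A₂ hβ')
    (hn β η A₃ hβ) (hn β' η' A₄ hβ') ?_ (Finset.Subset.refl _) (Finset.Subset.refl _)
  · rwa [Finset.powerset_infs_powerset_self, Finset.powerset_sups_powerset_self] at key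
  · intro a _ b _
    by_cases h1 : patch E a η ∈ A₁
    · by_cases h2 : patch E b η' ∈ A₂
      · have h3 : patch E (a ∩ b) η = patch E a η ⊓ patch E b η' := by
          funext e
          have := h e
          by_cases he : e ∈ E
          · by_cases ha : e ∈ a <;> by_cases hb : e ∈ b <;> simp [patch, he, ha, hb]
          · simp only [patch, he, if_false, Pi.inf_apply]
            exact (inf_eq_left.2 this).symm
        have h4 : patch E (a ∪ b) η' = patch E a η ⊔ patch E b η' := by
          funext e
          have := h e
          by_cases he : e ∈ E
          · by_cases ha : e ∈ a <;> by_cases hb : e ∈ b <;> simp [patch, he, ha, hb]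
          · simp only [patch, he, if_false, Pi.sup_apply]
            exact (sup_eq_right.2 this).symm
        have := hA _ h1 _ h2
        rw [if_pos h1, if_pos h2, if_pos (h3 ▸ this.1), if_pos (h4 ▸ this.2)]
        exact weight_patch_mul_le hβ hββ hq hE h a b
      · rw [if_neg h2, mul_zero]
        exact mul_nonneg (hn _ _ _ hβ _) (hn _ _ _ hβ' _)
    · rw [if_neg h1, zero_mul]
      exact mul_nonneg (hn _ _ _ hβ _) (hn _ _ _ hβ' _)

/-- Stochastic monotonicity in the inverse temperature and in the boundary condition. -/
theorem fkMeasure_real_mono (hβ : 0 ≤ β) (hββ : β ≤ β') (hq : 1 ≤ q)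
    (hE : ∀ e ∈ E, ∀ x ∈ e.1, x ∈ V) (h : η ≤ η') {A : Set (Config C)} (hA : IsUpperSet A) :
    (fkMeasure β q V E η).real A ≤ (fkMeasure β' q V E η').real A := by
  have := fkMeasure_four_events (A₁ := A) (A₂ := univ) (A₃ := univ) (A₄ := A) hβ hββ hq hE h
    fun ω hω ω' _ => ⟨trivial, hA le_sup_left hω⟩
  rwa [fkMeasure_real_univ (hβ.trans hββ) hq, fkMeasure_real_univ hβ hq, one_mul, mul_one]
    at this

end Weights

/-! ### Boxes (in the sup norm) and bonds of the lattice. -/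

section Lattice

theorem toEucl_apply (x : Site d) (i : Fin d) : toEucl x i = (x i : ℝ) := rfl

theorem norm_le_norm_toEucl (x : Site d) : ‖x‖ ≤ ‖toEucl x‖ := by
  refine (pi_norm_le_iff_of_nonneg (norm_nonneg _)).2 fun i => ?_
  have := PiLp.norm_apply_le (toEucl x) i
  rwa [toEucl_apply, Int.norm_cast_real] at this

/-- The box of radius `n` around `x`. -/
def boxAt (x : Site d) (n : ℕ) : Finset (Site d) := (box d n).map (addLeftEmbedding x)

theorem mem_box {n : ℕ} {x : Site d} : x ∈ box d n ↔ ‖x‖ ≤ n := by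
  rw [box, Finset.mem_Icc, pi_norm_le_iff_of_nonneg (Nat.cast_nonneg _), Pi.le_def, Pi.le_def,
    ← forall_and]
  refine forall_congr' fun i => ?_
  rw [Int.norm_eq_abs, abs_le]
  norm_cast

theorem mem_boxAt {x y : Site d} {n : ℕ} : y ∈ boxAt x n ↔ ‖y - x‖ ≤ n := by
  rw [boxAt, Finset.mem_map, ← mem_box]
  constructor
  · rintro ⟨z, hz, rfl⟩
    simpa using hz
  · intro h
    exact ⟨_, h, by simp⟩

end Lattice

section Bonds

variable {C : Coupling d}

theorem mem_edgeSet_bondGraph {x y : Site d} :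
    s(x, y) ∈ (bondGraph C).edgeSet ↔ x ≠ y ∧ 0 < C.J (y - x) := by
  rw [SimpleGraph.mem_edgeSet, bondGraph, SimpleGraph.fromRel_adj]
  refine and_congr_right fun _ => ?_
  rw [← C.symm (x - y), neg_sub, or_self]

theorem norm_sub_le_of_bond {x y : Site d} (h : s(x, y) ∈ (bondGraph C).edgeSet) :
    ‖y - x‖ ≤ C.R := by
  refine (norm_le_norm_toEucl _).trans ?_
  by_contra hlt
  have h := (mem_edgeSet_bondGraph.1 h).2
  rw [C.finite_range _ (not_le.1 hlt)] at h
  exact lt_irrefl _ h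

theorem norm_sub_le_of_mem_bond (e : Bond C) {x y : Site d} (hx : x ∈ e.1) (hy : y ∈ e.1) :
    ‖y - x‖ ≤ C.R := by
  by_cases hxy : x = y
  · rw [hxy, sub_self, norm_zero]
    exact C.R_pos.le
  · have h := (Sym2.mem_and_mem_iff hxy).1 ⟨hx, hy⟩
    exact norm_sub_le_of_bond (h ▸ e.2)

theorem finite_bonds_at (C : Coupling d) (V : Finset (Site d)) :
    {e : Bond C | ∃ x ∈ V, x ∈ e.1}.Finite := by
  have hfin : ((fun p : Site d × Site d => s(p.1, p.1 + p.2)) ''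
      ((V ×ˢ box d ⌈C.R⌉₊ : Finset (Site d × Site d)) : Set (Site d × Site d))).Finite :=
    (Finset.finite_toSet _).image _
  refine Set.Finite.of_finite_image (f := Subtype.val) (hfin.subset ?_)
    Subtype.val_injective.injOn
  rintro _ ⟨e, ⟨x, hx, hxe⟩, rfl⟩
  obtain ⟨y, hy⟩ := hxe
  refine ⟨(x, y - x), ?_, ?_⟩
  · simp only [Finset.coe_product, Set.mem_prod, Finset.mem_coe]
    refine ⟨hx, mem_box.2 ?_⟩
    exact (norm_sub_le_of_bond (hy ▸ e.2)).trans (Nat.le_ceil _)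
  · simp [hy]

/-- The bonds with at least one endpoint in `V`. -/
def bondsAt (C : Coupling d) (V : Finset (Site d)) : Finset (Bond C) :=
  (finite_bonds_at C V).toFinset

theorem mem_bondsAt {V : Finset (Site d)} {e : Bond C} :
    e ∈ bondsAt C V ↔ ∃ x ∈ V, x ∈ e.1 := by
  simp [bondsAt]

theorem mem_bondsIn {V : Finset (Site d)} {e : Bond C} :
    e ∈ bondsIn C V ↔ ∀ x ∈ e.1, x ∈ V := by
  rw [bondsIn, Finset.mem_subtype, Finset.mem_sym2_iff]

theorem bondsIn_subset_bondsAt (V : Finset (Site d)) : bondsIn C V ⊆ bondsAt C V := by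
  rintro ⟨e, he⟩ h
  rw [mem_bondsIn] at h
  rw [mem_bondsAt]
  induction e with
  | _ x y => exact ⟨x, h x (by simp), by simp⟩

theorem bondsIn_mono {V W : Finset (Site d)} (h : V ⊆ W) : bondsIn C V ⊆ bondsIn C W :=
  fun _ he => mem_bondsIn.2 fun x hx => h (mem_bondsIn.1 he x hx)

theorem bondsAt_mono {V W : Finset (Site d)} (h : V ⊆ W) : bondsAt C V ⊆ bondsAt C W :=
  fun _ he => mem_bondsAt.2 <| (mem_bondsAt.1 he).imp fun _ hx => ⟨h hx.1, hx.2⟩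

/-- The bonds with exactly one endpoint in `V`. -/
def edgeBoundary (C : Coupling d) (V : Finset (Site d)) : Finset (Bond C) :=
  bondsAt C V \ bondsIn C V

theorem mem_edgeBoundary_of_adj {V : Finset (Site d)} {x y : Site d}
    (h : s(x, y) ∈ (bondGraph C).edgeSet) (hx : x ∈ V) (hy : y ∉ V) :
    (⟨s(x, y), h⟩ : Bond C) ∈ edgeBoundary C V := by
  rw [edgeBoundary, Finset.mem_sdiff, mem_bondsAt, mem_bondsIn]
  refine ⟨⟨x, hx, by simp⟩, fun h' => hy (h' y (by simp))⟩

/-- The endpoints of the bonds of `F`. -/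
theorem exists_subset_bondsIn (F : Finset (Bond C)) :
    ∃ W : Finset (Site d), F ⊆ bondsIn C W := by
  refine ⟨F.biUnion fun e => e.1.toFinset, fun e he => mem_bondsIn.2 fun x hx => ?_⟩
  exact Finset.mem_biUnion.2 ⟨e, he, Sym2.mem_toFinset.2 hx⟩

end Bonds

/-! ### Local events. -/

section Local

variable {C : Coupling d}

/-- The event `X` is determined by the states of the bonds of `F`. -/
def LocalOn (F : Finset (Bond C)) (X : Set (Config C)) : Prop :=
  ∀ ω ω' : Config C, (∀ e ∈ F, ω e = ω' e) → ω ∈ X → ω' ∈ X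

theorem LocalOn.mono {F F' : Finset (Bond C)} {X : Set (Config C)} (h : LocalOn F X)
    (hF : F ⊆ F') : LocalOn F' X := fun ω ω' ha => h ω ω' fun e he => ha e (hF he)

theorem LocalOn.iff {F : Finset (Bond C)} {X : Set (Config C)} (h : LocalOn F X)
    {ω ω' : Config C} (ha : ∀ e ∈ F, ω e = ω' e) : ω ∈ X ↔ ω' ∈ X :=
  ⟨h ω ω' ha, h ω' ω fun e he => (ha e he).symm⟩

theorem LocalOn.compl {F : Finset (Bond C)} {X : Set (Config C)} (h : LocalOn F X) :
    LocalOn F Xᶜ := fun _ _ ha hω hω' => hω ((h.iff ha).2 hω')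

theorem LocalOn.inter {F F' : Finset (Bond C)} {X Y : Set (Config C)} (h : LocalOn F X)
    (h' : LocalOn F' Y) : LocalOn (F ∪ F') (X ∩ Y) := fun ω ω' ha hω =>
  ⟨h ω ω' (fun e he => ha e (Finset.mem_union_left _ he)) hω.1,
    h' ω ω' (fun e he => ha e (Finset.mem_union_right _ he)) hω.2⟩

/-- The σ-algebra is a variable because the argument serves both the product σ-algebra and
`outsideSigma`. -/
theorem LocalOn.measurableSet' {m : MeasurableSpace (Config C)} {F : Finset (Bond C)}
    {X : Set (Config C)} (h : LocalOn F X)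
    (hm : ∀ e ∈ F, Measurable[m] fun ω : Config C => ω e) : MeasurableSet[m] X := by
  set f : Config C → ({e // e ∈ F} → Bool) := fun ω e => ω e.1
  have hf : Measurable[m] f := by
    rw [measurable_pi_iff]
    exact fun e => hm e.1 e.2
  have hX : X = f ⁻¹' (f '' X) := by
    refine Subset.antisymm (subset_preimage_image f X) ?_
    rintro ω ⟨ω', hω', he⟩
    exact h ω' ω (fun e he' => congrFun he ⟨e, he'⟩) hω'
  rw [hX]
  exact hf (Set.toFinite _).measurableSet

theorem LocalOn.measurableSet {F : Finset (Bond C)} {X : Set (Config C)} (h : LocalOn F X) :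
    MeasurableSet X := h.measurableSet' fun e _ => measurable_pi_apply e

theorem LocalOn.measurableSet_outside {F : Finset (Bond C)} {X : Set (Config C)}
    (h : LocalOn F X) {Λ : Finset (Site d)} (hF : Disjoint F (bondsIn C Λ)) :
    MeasurableSet[outsideSigma C Λ] X := by
  refine h.measurableSet' fun e he => ?_
  have h' : e ∉ bondsIn C Λ := Finset.disjoint_left.1 hF he
  exact fun s hs => ⟨(fun f => f ⟨e, h'⟩) ⁻¹' s, measurable_pi_apply _ hs, rfl⟩

/-- The event that all bonds of `S` are closed. -/
def closedOn (S : Finset (Bond C)) : Set (Config C) := {ω | ∀ e ∈ S, ω e = false}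

theorem localOn_closedOn (S : Finset (Bond C)) : LocalOn S (closedOn S) :=
  fun _ _ ha hω e he => (ha e he).symm.trans (hω e he)

theorem isLowerSet_closedOn (S : Finset (Bond C)) : IsLowerSet (closedOn S) := by
  intro ω ω' h hω e he
  have h' := h e
  rw [hω e he] at h'
  exact le_bot_iff.1 h'

theorem closedOn_union (S T : Finset (Bond C)) :
    closedOn (S ∪ T) = closedOn S ∩ closedOn T := by
  ext ω
  simp only [closedOn, Finset.mem_union, mem_ofPred_eq, mem_inter_iff]
  exact ⟨fun h => ⟨fun e he => h e (Or.inl he), fun e he => h e (Or.inr he)⟩,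
    fun h e he => he.elim (h.1 e) (h.2 e)⟩

theorem closedOn_anti {S T : Finset (Bond C)} (h : S ⊆ T) : closedOn T ⊆ closedOn S :=
  fun _ hω e he => hω e (h he)

theorem closedOn_empty : closedOn (∅ : Finset (Bond C)) = univ := by
  ext ω; simp [closedOn]

theorem sup_mem_closedOn {S : Finset (Bond C)} {ω ω' : Config C} (h : ω ∈ closedOn S)
    (h' : ω' ∈ closedOn S) : ω ⊔ ω' ∈ closedOn S := by
  intro e he
  rw [Pi.sup_apply, h e he, h' e he]
  rfl

end Local

/-! ### The domain Markov property behind a closed boundary. -/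

section Isolation

variable {C : Coupling d}

/-- A path starting in V cannot cross the closed boundary, so it uses only bonds inside V, where the
configurations agree. Only the first configuration has to be sealed. -/
theorem reachable_of_eqOn {V : Finset (Site d)} {ω ω' : Config C}
    (h : ∀ e ∈ bondsIn C V, ω e = ω' e) (hω : ω ∈ closedOn (edgeBoundary C V))
    {x y : Site d} (hx : x ∈ V) (hr : (openGraph ω).Reachable x y) :
    y ∈ V ∧ (openGraph ω').Reachable x y := by
  rw [SimpleGraph.reachable_iff_reflTransGen] at hr
  induction hr with
  | refl => exact ⟨hx, .refl _⟩
  | @tail a b _ hab ih =>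
    obtain ⟨ha, hxa⟩ := ih
    obtain ⟨he, ho⟩ := openGraph_adj.1 hab
    have hb : b ∈ V := by
      by_contra hb
      have := hω _ (mem_edgeBoundary_of_adj he ha hb)
      rw [ho] at this
      exact absurd this (by decide)
    refine ⟨hb, hxa.trans (SimpleGraph.Adj.reachable (openGraph_adj.2 ⟨he, ?_⟩))⟩
    rw [← h, ho]
    rw [mem_bondsIn]
    intro z hz
    rcases Sym2.mem_iff.1 hz with rfl | rfl
    exacts [ha, hb]

theorem clusterCount_eq_of_eqOn {V : Finset (Site d)} {ω ω' : Config C}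
    (h : ∀ e ∈ bondsIn C V, ω e = ω' e) (hω : ω ∈ closedOn (edgeBoundary C V))
    (hω' : ω' ∈ closedOn (edgeBoundary C V)) : clusterCount V ω = clusterCount V ω' := by
  refine card_image_eq_of_ker V _ _ fun x hx y _ => ?_
  rw [SimpleGraph.ConnectedComponent.eq, SimpleGraph.ConnectedComponent.eq]
  exact ⟨fun hr => (reachable_of_eqOn h hω hx hr).2,
    fun hr => (reachable_of_eqOn (fun e he => (h e he).symm) hω' hx hr).2⟩

/-- The probability of `X` under the free measure of `V`. -/
def freeProb (C : Coupling d) (β q : ℝ) (V : Finset (Site d)) (X : Set (Config C)) : ℝ :=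
  (boxMeasure C β q V fun _ => false).real X

/-- A boundary condition acts inside V only by joining clusters through the outside, which a closed
edge boundary prevents. -/
theorem boxMeasure_real_eq_freeProb {β q : ℝ} (hβ : 0 ≤ β) (hq : 1 ≤ q) {V : Finset (Site d)}
    {η : Config C} (hη : η ∈ closedOn (edgeBoundary C V)) {X : Set (Config C)}
    (hX : LocalOn (bondsIn C V) X) :
    (boxMeasure C β q V η).real X = freeProb C β q V X := by
  have hagree : ∀ s, ∀ e ∈ bondsIn C V,
      patch (bondsIn C V) s η e = patch (bondsIn C V) s (fun _ => false) e := by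
    intro s e he
    simp [patch, he]
  have hcl : ∀ s, ∀ η ∈ closedOn (edgeBoundary C V),
      patch (bondsIn C V) s η ∈ closedOn (edgeBoundary C V) := by
    intro s η hη e he
    have : e ∉ bondsIn C V := (Finset.mem_sdiff.1 he).2
    simpa [patch, this] using hη e he
  have hw : ∀ s, weight β q V (bondsIn C V) (patch (bondsIn C V) s η)
      = weight β q V (bondsIn C V) (patch (bondsIn C V) s fun _ => false) := by
    intro s
    rw [weight, weight, clusterCount_eq_of_eqOn (hagree s) (hcl s η hη)
      (hcl s _ fun _ _ => rfl)]
    congr 1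
    exact Finset.prod_congr rfl fun e he => by rw [hagree s e he]
  rw [freeProb, boxMeasure, boxMeasure, fkMeasure_real hβ hq, fkMeasure_real hβ hq, partitionFn,
    partitionFn]
  simp_rw [hw, hX.iff (hagree _)]

end Isolation

section DLR

variable {C : Coupling d} {β q : ℝ} {P : Measure (Config C)}

theorem outsideSigma_le (C : Coupling d) (Λ : Finset (Site d)) :
    outsideSigma C Λ ≤ MeasurableSpace.pi :=
  Measurable.comap_le (measurable_pi_iff.2 fun e => measurable_pi_apply e.1)

theorem IsRandomClusterMeasure.integrable (hP : IsRandomClusterMeasure C β q P)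
    (Λ : Finset (Site d)) {A : Set (Config C)} (hA : MeasurableSet A) :
    Integrable (fun η => (boxMeasure C β q Λ η).real A) P :=
  integrable_condExp.congr (hP.2 Λ A hA)

theorem IsRandomClusterMeasure.real_inter (hP : IsRandomClusterMeasure C β q P)
    (Λ : Finset (Site d)) {A B : Set (Config C)} (hA : MeasurableSet A)
    (hB : MeasurableSet[outsideSigma C Λ] B) :
    P.real (A ∩ B) = ∫ η in B, (boxMeasure C β q Λ η).real A ∂P := by
  have := hP.1
  have hB' : MeasurableSet B := outsideSigma_le C Λ B hB
  rw [← setIntegral_congr_ae hB' ((hP.2 Λ A hA).mono fun η h _ => h),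
    setIntegral_condExp (outsideSigma_le C Λ) ((integrable_const _).indicator hA) hB,
    integral_indicator hA, Measure.restrict_restrict hA]
  simp

theorem IsRandomClusterMeasure.real_inter_le (hP : IsRandomClusterMeasure C β q P)
    (Λ : Finset (Site d)) {A B : Set (Config C)} (hA : MeasurableSet A)
    (hB : MeasurableSet[outsideSigma C Λ] B) {c : ℝ}
    (hc : ∀ η ∈ B, (boxMeasure C β q Λ η).real A ≤ c) : P.real (A ∩ B) ≤ c * P.real B := by
  have := hP.1
  rw [hP.real_inter Λ hA hB]
  have h := setIntegral_mono_on (hP.integrable Λ hA).integrableOn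
    (integrable_const c).integrableOn (outsideSigma_le C Λ B hB) hc
  simpa [mul_comm] using h

theorem IsRandomClusterMeasure.le_real_inter (hP : IsRandomClusterMeasure C β q P)
    (Λ : Finset (Site d)) {A B : Set (Config C)} (hA : MeasurableSet A)
    (hB : MeasurableSet[outsideSigma C Λ] B) {c : ℝ}
    (hc : ∀ η ∈ B, c ≤ (boxMeasure C β q Λ η).real A) : c * P.real B ≤ P.real (A ∩ B) := by
  have := hP.1
  rw [hP.real_inter Λ hA hB]
  have h := setIntegral_mono_on (integrable_const c).integrableOn
    (hP.integrable Λ hA).integrableOn (outsideSigma_le C Λ B hB) hc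
  simpa [mul_comm] using h

theorem IsRandomClusterMeasure.real_le (hP : IsRandomClusterMeasure C β q P)
    (Λ : Finset (Site d)) {A : Set (Config C)} (hA : MeasurableSet A) {c : ℝ}
    (hc : ∀ η, (boxMeasure C β q Λ η).real A ≤ c) : P.real A ≤ c := by
  have := hP.1
  simpa using hP.real_inter_le Λ hA MeasurableSet.univ fun η _ => hc η

theorem IsRandomClusterMeasure.le_real (hP : IsRandomClusterMeasure C β q P)
    (Λ : Finset (Site d)) {A : Set (Config C)} (hA : MeasurableSet A) {c : ℝ}
    (hc : ∀ η, c ≤ (boxMeasure C β q Λ η).real A) : c ≤ P.real A := by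
  have := hP.1
  simpa using hP.le_real_inter Λ hA MeasurableSet.univ fun η _ => hc η

/-- Given that the boundary of `V` is closed, the law inside `V` is the free one, whatever
happens outside. -/
theorem IsRandomClusterMeasure.real_isolated (hP : IsRandomClusterMeasure C β q P) (hβ : 0 ≤ β)
    (hq : 1 ≤ q) (V : Finset (Site d)) {X B : Set (Config C)} (hX : LocalOn (bondsIn C V) X)
    {F : Finset (Bond C)} (hB : LocalOn F B) (hF : Disjoint F (bondsIn C V)) :
    P.real (X ∩ (closedOn (edgeBoundary C V) ∩ B))
      = freeProb C β q V X * P.real (closedOn (edgeBoundary C V) ∩ B) := by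
  have hm : MeasurableSet[outsideSigma C V] (closedOn (edgeBoundary C V) ∩ B) :=
    ((localOn_closedOn _).inter hB).measurableSet_outside
      (Finset.disjoint_union_left.2 ⟨Finset.sdiff_disjoint, hF⟩)
  refine le_antisymm ?_ ?_
  · exact hP.real_inter_le V hX.measurableSet hm fun η hη =>
      (boxMeasure_real_eq_freeProb hβ hq hη.1 hX).le
  · exact hP.le_real_inter V hX.measurableSet hm fun η hη =>
      (boxMeasure_real_eq_freeProb hβ hq hη.1 hX).ge

end DLR

/-! ### Translations. -/

section Translation

variable {C : Coupling d}

theorem map_add_mem_edgeSet (v : Site d) {e : Sym2 (Site d)} (he : e ∈ (bondGraph C).edgeSet) :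
    Sym2.map (fun x => v + x) e ∈ (bondGraph C).edgeSet := by
  induction e with
  | _ x y =>
    rw [Sym2.map_mk, mem_edgeSet_bondGraph, add_sub_add_left_eq_sub]
    rw [mem_edgeSet_bondGraph] at he
    exact ⟨fun h => he.1 (add_left_cancel h), he.2⟩

theorem map_add_map_neg_add (v : Site d) (e : Sym2 (Site d)) :
    Sym2.map (fun x => v + x) (Sym2.map (fun x => -v + x) e) = e := by
  induction e with
  | _ x y => simp

/-- Translation of bonds. -/
def shiftBond (C : Coupling d) (v : Site d) : Bond C ≃ Bond C where
  toFun e := ⟨Sym2.map (fun x => v + x) e.1, map_add_mem_edgeSet v e.2⟩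
  invFun e := ⟨Sym2.map (fun x => -v + x) e.1, map_add_mem_edgeSet (-v) e.2⟩
  left_inv e := Subtype.ext (by simpa using map_add_map_neg_add (-v) e.1)
  right_inv e := Subtype.ext (map_add_map_neg_add v e.1)

theorem mem_shiftBond {v x : Site d} {e : Bond C} :
    v + x ∈ (shiftBond C v e).1 ↔ x ∈ e.1 := by
  change v + x ∈ Sym2.map (fun x => v + x) e.1 ↔ _
  rw [Sym2.mem_map]
  simp

/-- The configuration seen from `v`. -/
def shiftConfig (v : Site d) (ω : Config C) : Config C := fun e => ω (shiftBond C v e)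

theorem openGraph_shiftConfig_adj (v : Site d) (ω : Config C) (x y : Site d) :
    (openGraph ω).Adj (v + x) (v + y) ↔ (openGraph (shiftConfig v ω)).Adj x y := by
  rw [openGraph_adj, openGraph_adj]
  constructor
  · rintro ⟨h, ho⟩
    have h' : s(x, y) ∈ (bondGraph C).edgeSet := by
      rw [mem_edgeSet_bondGraph] at h ⊢
      rw [add_sub_add_left_eq_sub] at h
      exact ⟨fun h' => h.1 (by rw [h']), h.2⟩
    exact ⟨h', ho⟩
  · rintro ⟨h, ho⟩
    exact ⟨map_add_mem_edgeSet v h, ho⟩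

/-- Translation as an isomorphism of graphs of open bonds. -/
def openGraphShift (v : Site d) (ω : Config C) :
    openGraph (shiftConfig v ω) ≃g openGraph ω where
  toEquiv := Equiv.addLeft v
  map_rel_iff' := openGraph_shiftConfig_adj v ω _ _

theorem reachable_shiftConfig (v : Site d) (ω : Config C) (x y : Site d) :
    (openGraph ω).Reachable (v + x) (v + y) ↔ (openGraph (shiftConfig v ω)).Reachable x y :=
  (openGraphShift v ω).reachable_iff

theorem clusterCount_map_add (v : Site d) (V : Finset (Site d)) (ω : Config C) :
    clusterCount (V.map (addLeftEmbedding v)) ω = clusterCount V (shiftConfig v ω) := by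
  rw [clusterCount, Finset.map_eq_image, Finset.image_image, clusterCount]
  refine card_image_eq_of_ker V _ _ fun x _ y _ => ?_
  rw [SimpleGraph.ConnectedComponent.eq, ← reachable_shiftConfig,
    ← SimpleGraph.ConnectedComponent.eq]
  rfl

theorem couplingOf_shiftBond (v : Site d) (e : Bond C) :
    couplingOf C (shiftBond C v e).1 = couplingOf C e.1 := by
  obtain ⟨e, he⟩ := e
  induction e with
  | _ x y =>
    change C.J (v + y - (v + x)) = C.J (y - x)
    rw [add_sub_add_left_eq_sub]

theorem weight_map_add (β q : ℝ) (v : Site d) (V : Finset (Site d)) (E : Finset (Bond C))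
    (ω : Config C) :
    weight β q (V.map (addLeftEmbedding v)) (E.map (shiftBond C v).toEmbedding) ω
      = weight β q V E (shiftConfig v ω) := by
  rw [weight, weight, clusterCount_map_add, Finset.prod_map]
  simp only [openProb, Equiv.toEmbedding_apply, couplingOf_shiftBond]
  rfl

theorem shiftConfig_patch_map (v : Site d) (E s : Finset (Bond C)) (η : Config C) :
    shiftConfig v (patch (E.map (shiftBond C v).toEmbedding) (s.map (shiftBond C v).toEmbedding) η)
      = patch E s (shiftConfig v η) := by
  funext e
  simp [shiftConfig, patch]

theorem bondsIn_map_add (v : Site d) (V : Finset (Site d)) :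
    bondsIn C (V.map (addLeftEmbedding v)) = (bondsIn C V).map (shiftBond C v).toEmbedding := by
  ext e
  obtain ⟨e, rfl⟩ := (shiftBond C v).surjective e
  rw [Finset.mem_map_equiv, Equiv.symm_apply_apply, mem_bondsIn, mem_bondsIn]
  constructor
  · intro h x hx
    have := h (v + x) (mem_shiftBond.2 hx)
    simpa using this
  · intro h x hx
    obtain ⟨y, rfl⟩ : ∃ y, x = v + y := ⟨-v + x, by simp⟩
    simpa using h y (mem_shiftBond.1 hx)

theorem boxMeasure_map_add {β q : ℝ} (hβ : 0 ≤ β) (hq : 1 ≤ q) (v : Site d)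
    (V : Finset (Site d)) (η : Config C) (X : Set (Config C)) :
    (boxMeasure C β q (V.map (addLeftEmbedding v)) η).real (shiftConfig v ⁻¹' X)
      = (boxMeasure C β q V (shiftConfig v η)).real X := by
  rw [boxMeasure, boxMeasure, fkMeasure_real hβ hq, fkMeasure_real hβ hq, partitionFn,
    partitionFn, bondsIn_map_add]
  have key : ∀ F : Config C → ℝ,
      ∑ s ∈ (bondsIn C V).powerset, F (patch (bondsIn C V) s (shiftConfig v η))
        = ∑ s ∈ ((bondsIn C V).map (shiftBond C v).toEmbedding).powerset,
          F (shiftConfig v (patch ((bondsIn C V).map (shiftBond C v).toEmbedding) s η)) := by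
    intro F
    refine Finset.sum_equiv (shiftBond C v).finsetCongr (fun s => ?_) fun s _ => ?_
    · rw [Finset.mem_powerset, Finset.mem_powerset, Equiv.finsetCongr_apply,
        Finset.map_subset_map]
    · rw [Equiv.finsetCongr_apply, shiftConfig_patch_map]
  rw [key (fun ω => if ω ∈ X then weight β q V (bondsIn C V) ω else 0),
    key (fun ω => weight β q V (bondsIn C V) ω)]
  simp only [weight_map_add, mem_preimage]

end Translation

/-! ### Exponential decay of connectivities under P. -/

section Decay

variable {C : Coupling d}

/-- The event that `x` is connected to the complement of `Λ`. -/
def reachOut (C : Coupling d) (x : Site d) (Λ : Finset (Site d)) : Set (Config C) :=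
  {ω | ∃ y, y ∉ Λ ∧ (openGraph ω).Reachable x y}

theorem isUpperSet_reachOut (x : Site d) (Λ : Finset (Site d)) :
    IsUpperSet (reachOut C x Λ) := fun _ _ h hω =>
  hω.imp fun _ hy => ⟨hy.1, hy.2.mono (openGraph_mono h)⟩

theorem localOn_reachOut (x : Site d) (Λ : Finset (Site d)) :
    LocalOn (bondsAt C Λ) (reachOut C x Λ) := by
  intro ω ω' ha ⟨y, hy, hr⟩
  by_contra hn
  -- If the cluster of x under ω' stays in Λ, each bond that it meets is one on which ω and ω'
  -- agree, so every open path of ω from x is also open in ω'.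
  have hn : ∀ z, (openGraph ω').Reachable x z → z ∈ Λ := fun z hz => by
    by_contra hzΛ
    exact hn ⟨z, hzΛ, hz⟩
  refine hy (hn y ?_)
  clear hy
  rw [SimpleGraph.reachable_iff_reflTransGen] at hr
  induction hr with
  | refl => exact .refl _
  | @tail a b _ hab ih =>
    obtain ⟨he, ho⟩ := openGraph_adj.1 hab
    refine ih.trans (SimpleGraph.Adj.reachable (openGraph_adj.2 ⟨he, ?_⟩))
    rw [← ha, ho]
    exact mem_bondsAt.2 ⟨a, hn a ih, by simp⟩

theorem reachOut_anti (x : Site d) {Λ Λ' : Finset (Site d)} (h : Λ ⊆ Λ') :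
    reachOut C x Λ' ⊆ reachOut C x Λ :=
  fun _ hω => hω.imp fun _ hy => ⟨fun hy' => hy.1 (h hy'), hy.2⟩

theorem preimage_shiftConfig_reachOut (v x : Site d) (Λ : Finset (Site d)) :
    shiftConfig v ⁻¹' reachOut C x Λ = reachOut C (v + x) (Λ.map (addLeftEmbedding v)) := by
  ext ω
  constructor
  · rintro ⟨y, hy, hr⟩
    exact ⟨v + y, by simpa using hy, (reachable_shiftConfig v ω x y).2 hr⟩
  · rintro ⟨y, hy, hr⟩
    obtain ⟨y, rfl⟩ : ∃ z, y = v + z := ⟨-v + y, by simp⟩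
    exact ⟨y, by simpa using hy, (reachable_shiftConfig v ω x y).1 hr⟩

/-- Exponential decay of connectivities, uniformly in the starting point. -/
def UniformDecay (P : Measure (Config C)) (ν₀ ν₁ : ℝ) : Prop :=
  ∀ (x : Site d) (n : ℕ), P.real (reachOut C x (boxAt x n)) ≤ ν₀ * Real.exp (-ν₁ * n)

/-- Some β' > β has wired decay, and the wired measure at β' dominates every boundary condition at
β. The wired measure around x is a translate of the one around 0, hence constants independent of x.
-/
theorem IsRandomClusterMeasure.exists_uniformDecay {β q : ℝ} {P : Measure (Config C)}
    (hP : IsRandomClusterMeasure C β q P) (hβ : 0 ≤ β) (hq : 1 ≤ q)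
    (hβc : (β : EReal) < betaHat C q) :
    ∃ ν₀ ν₁ : ℝ, 0 < ν₀ ∧ 0 < ν₁ ∧ UniformDecay P ν₀ ν₁ := by
  obtain ⟨_, ⟨β', rfl, hβ', ν₀, ν₁, h0, h1, hdec⟩, hlt⟩ := lt_sSup_iff.1 hβc
  have hlt : β < β' := EReal.coe_lt_coe_iff.1 hlt
  refine ⟨ν₀, ν₁, h0, h1, fun x n => ?_⟩
  refine hP.real_le (boxAt x n) (localOn_reachOut _ _).measurableSet fun η => ?_
  refine (fkMeasure_real_mono hβ hlt.le hq (fun e he => mem_bondsIn.1 he)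
    (η' := fun _ => true) (fun e => le_top) (isUpperSet_reachOut _ _)).trans ?_
  have h2 := boxMeasure_map_add hβ' hq x (box d n) (fun _ => true) (reachOut C 0 (box d n))
  rw [preimage_shiftConfig_reachOut, add_zero] at h2
  exact h2.le.trans (hdec n)

end Decay

variable {C : Coupling d}

/-! ### Exploring the clusters of a finite set. -/

section Exploration

/-- The event that the open bonds inside `V` are exactly those of `s`. -/
def patternOn (V : Finset (Site d)) (s : Finset (Bond C)) : Set (Config C) :=
  {ω | ∀ e ∈ bondsIn C V, ω e = decide (e ∈ s)}

theorem localOn_patternOn (V : Finset (Site d)) (s : Finset (Bond C)) :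
    LocalOn (bondsIn C V) (patternOn V s) :=
  fun _ _ ha hω e he => (ha e he).symm.trans (hω e he)

/-- The event that `V` is isolated from its complement and the open bonds inside `V` are exactly
those of `s`. -/
def isolatedPattern (V : Finset (Site d)) (s : Finset (Bond C)) : Set (Config C) :=
  patternOn V s ∩ closedOn (edgeBoundary C V)

theorem measurableSet_isolatedPattern (V : Finset (Site d)) (s : Finset (Bond C)) :
    MeasurableSet (isolatedPattern V s) :=
  (localOn_patternOn V s).measurableSet.inter (localOn_closedOn _).measurableSet

/-- The sites of `Λ` that are connected to `W`. -/
def clusterIn (Λ W : Finset (Site d)) (ω : Config C) : Finset (Site d) :=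
  Λ.filter fun z => ∃ x ∈ W, (openGraph ω).Reachable x z

/-- The event that `W` is connected to the complement of `Λ`. -/
def reachOutFrom (C : Coupling d) (W Λ : Finset (Site d)) : Set (Config C) :=
  ⋃ x ∈ W, reachOut C x Λ

theorem exists_of_mem_edgeBoundary {V : Finset (Site d)} {e : Bond C}
    (he : e ∈ edgeBoundary C V) : ∃ x y, x ∈ V ∧ y ∉ V ∧ e.1 = s(x, y) := by
  rw [edgeBoundary, Finset.mem_sdiff, mem_bondsAt, mem_bondsIn] at he
  obtain ⟨⟨x, hx, hxe⟩, h⟩ := he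
  push Not at h
  obtain ⟨y, hye, hy⟩ := h
  have hxy : x ≠ y := fun h => hy (h ▸ hx)
  exact ⟨x, y, hx, hy, (Sym2.mem_and_mem_iff hxy).1 ⟨hxe, hye⟩⟩

theorem mem_closedOn_edgeBoundary_clusterIn {Λ W : Finset (Site d)} {ω : Config C}
    (h : ω ∉ reachOutFrom C W Λ) : ω ∈ closedOn (edgeBoundary C (clusterIn Λ W ω)) := by
  intro e he
  obtain ⟨x, y, hx, hy, hxy⟩ := exists_of_mem_edgeBoundary he
  obtain ⟨e, hE⟩ := e
  change e = s(x, y) at hxy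
  subst hxy
  by_contra ho
  rw [Bool.not_eq_false] at ho
  obtain ⟨-, z, hz, hzx⟩ := Finset.mem_filter.1 hx
  have hzy : (openGraph ω).Reachable z y :=
    hzx.trans (SimpleGraph.Adj.reachable (openGraph_adj.2 ⟨hE, ho⟩))
  by_cases hyΛ : y ∈ Λ
  · exact hy (Finset.mem_filter.2 ⟨hyΛ, z, hz, hzy⟩)
  · exact h (mem_biUnion hz ⟨y, hyΛ, hzy⟩)

theorem mem_isolatedPattern_clusterIn {Λ W : Finset (Site d)} {ω : Config C}
    (h : ω ∉ reachOutFrom C W Λ) :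
    ω ∈ isolatedPattern (clusterIn Λ W ω)
      ((bondsIn C (clusterIn Λ W ω)).filter fun e => ω e = true) := by
  refine ⟨fun e he => ?_, mem_closedOn_edgeBoundary_clusterIn h⟩
  by_cases ho : ω e = true <;> simp [he, ho]

theorem subset_clusterIn {Λ W : Finset (Site d)} (hW : W ⊆ Λ) (ω : Config C) :
    W ⊆ clusterIn Λ W ω := fun x hx =>
  Finset.mem_filter.2 ⟨hW hx, x, hx, .refl _⟩

theorem eqOn_of_mem_isolatedPattern {V : Finset (Site d)} {ω ω' : Config C}
    (h : ω' ∈ isolatedPattern V ((bondsIn C V).filter fun e => ω e = true)) :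
    ∀ e ∈ bondsIn C V, ω e = ω' e := by
  intro e he
  rw [h.1 e he]
  by_cases ho : ω e = true <;> simp [he, ho]

/-- The stopping-set property: the explored region is recognised from the bonds inside it and on its
boundary, so changing the configuration elsewhere leads to the same exploration. -/
theorem clusterIn_eq_of_mem_isolatedPattern {Λ W : Finset (Site d)} (hW : W ⊆ Λ)
    {ω ω' : Config C} (h : ω ∉ reachOutFrom C W Λ)
    (h' : ω' ∈ isolatedPattern (clusterIn Λ W ω)
      ((bondsIn C (clusterIn Λ W ω)).filter fun e => ω e = true)) :
    ω' ∉ reachOutFrom C W Λ ∧ clusterIn Λ W ω' = clusterIn Λ W ω := by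
  have ha := eqOn_of_mem_isolatedPattern h'
  have hcl := mem_closedOn_edgeBoundary_clusterIn h
  have hfw : ∀ x ∈ W, ∀ y, (openGraph ω).Reachable x y → (openGraph ω').Reachable x y :=
    fun x hx y hr => (reachable_of_eqOn ha hcl (subset_clusterIn hW ω hx) hr).2
  have hbw : ∀ x ∈ W, ∀ y, (openGraph ω').Reachable x y →
      y ∈ clusterIn Λ W ω ∧ (openGraph ω).Reachable x y :=
    fun x hx y hr => reachable_of_eqOn (fun e he => (ha e he).symm) h'.2
      (subset_clusterIn hW ω hx) hr
  constructor
  · intro hbad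
    rw [reachOutFrom, mem_iUnion₂] at hbad
    obtain ⟨x, hx, y, hy, hr⟩ := hbad
    exact hy (Finset.mem_filter.1 (hbw x hx y hr).1).1
  · refine Finset.filter_congr fun z _ => ?_
    exact ⟨fun ⟨x, hx, hr⟩ => ⟨x, hx, (hbw x hx z hr).2⟩,
      fun ⟨x, hx, hr⟩ => ⟨x, hx, hfw x hx z hr⟩⟩

/-- Comparison of two measures by exploring the clusters of `W`. -/
theorem real_le_of_isolatedPattern_le (μ ν : Measure (Config C)) [IsFiniteMeasure μ]
    [IsFiniteMeasure ν] {W Λ : Finset (Site d)} (hW : W ⊆ Λ)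
    (h : ∀ V ⊆ Λ, ∀ s : Finset (Bond C),
      μ.real (isolatedPattern V s) ≤ ν.real (isolatedPattern V s))
    {A : Set (Config C)} (hA : LocalOn (bondsIn C W) A) :
    μ.real A ≤ ν.real A + μ.real (A ∩ reachOutFrom C W Λ) := by
  set T : Config C → Finset (Site d) × Finset (Bond C) := fun ω =>
    (clusterIn Λ W ω, (bondsIn C (clusterIn Λ W ω)).filter fun e => ω e = true) with hT
  set I := Λ.powerset ×ˢ (bondsIn C Λ).powerset with hI
  set G := A \ reachOutFrom C W Λ with hG
  have hTI : ∀ ω, T ω ∈ I := by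
    intro ω
    have hs : clusterIn Λ W ω ⊆ Λ := Finset.filter_subset _ _
    rw [hI, Finset.mem_product, Finset.mem_powerset, Finset.mem_powerset]
    exact ⟨hs, (Finset.filter_subset _ _).trans (bondsIn_mono hs)⟩
  -- A nonempty fibre of the exploration is a complete isolated pattern, so on A without the escape
  -- event a comparison of patterns sums to a comparison of the measures.
  have hfib : ∀ i ∈ I, G ∩ T ⁻¹' {i} = ∅ ∨ G ∩ T ⁻¹' {i} = isolatedPattern i.1 i.2 := by
    intro i _
    rcases (G ∩ T ⁻¹' {i}).eq_empty_or_nonempty with he | ⟨ω₀, ⟨hA₀, hn₀⟩, rfl⟩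
    · exact Or.inl he
    · right
      ext ω
      constructor
      · rintro ⟨⟨-, hn⟩, hTω⟩
        rw [← show T ω = T ω₀ from hTω]
        exact mem_isolatedPattern_clusterIn hn
      · intro hω
        obtain ⟨h1, h2⟩ := clusterIn_eq_of_mem_isolatedPattern hW hn₀ hω
        have ha := eqOn_of_mem_isolatedPattern hω
        refine ⟨⟨?_, h1⟩, ?_⟩
        · exact hA ω₀ ω (fun e he => ha e (bondsIn_mono (subset_clusterIn hW ω₀) he)) hA₀
        · change T ω = T ω₀
          simp only [hT, h2, Prod.mk.injEq, true_and]
          exact Finset.filter_congr fun e he => by rw [ha e he]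
  have hsum : ∀ ρ : Measure (Config C), IsFiniteMeasure ρ →
      ρ.real G = ∑ i ∈ I, ρ.real (G ∩ T ⁻¹' {i}) := by
    intro ρ _
    rw [← measureReal_biUnion_finset]
    · congr 1
      ext ω
      simp only [mem_iUnion, mem_inter_iff, mem_preimage, mem_singleton_iff, exists_prop]
      exact ⟨fun h => ⟨T ω, hTI ω, h, rfl⟩, fun ⟨_, _, h, _⟩ => h⟩
    · intro i _ j _ hij
      refine Set.disjoint_left.2 fun ω h1 h2 => hij ?_
      rw [← show T ω = i from h1.2, show T ω = j from h2.2]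
    · intro i hi
      rcases hfib i hi with h0 | h0 <;> rw [h0]
      exacts [MeasurableSet.empty, measurableSet_isolatedPattern _ _]
  have hle : μ.real G ≤ ν.real A := by
    refine le_trans ?_ (measureReal_mono (sdiff_subset : G ⊆ A))
    rw [hsum μ inferInstance, hsum ν inferInstance]
    refine Finset.sum_le_sum fun i hi => ?_
    rcases hfib i hi with h0 | h0 <;> rw [h0]
    · simp
    · exact h i.1 (Finset.mem_powerset.1 (Finset.mem_product.1 hi).1) i.2
  have : μ.real A ≤ μ.real G + μ.real (A ∩ reachOutFrom C W Λ) := by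
    refine le_trans (le_of_eq ?_) (measureReal_union_le _ _)
    rw [hG, Set.sdiff_union_inter]
  linarith

end Exploration

/-! ### P as the limit of free measures, infinite-volume FKG, translation invariance. -/

section Uniqueness

variable {β q : ℝ} {P : Measure (Config C)}

theorem fkMeasure_real_anti {β' : ℝ} {V : Finset (Site d)} {E : Finset (Bond C)}
    {η η' : Config C} (hβ : 0 ≤ β) (hββ : β ≤ β') (hq : 1 ≤ q)
    (hE : ∀ e ∈ E, ∀ x ∈ e.1, x ∈ V) (h : η ≤ η') {A : Set (Config C)} (hA : IsLowerSet A) :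
    (fkMeasure β' q V E η').real A ≤ (fkMeasure β q V E η).real A := by
  have := fkMeasure_four_events (A₁ := univ) (A₂ := A) (A₃ := A) (A₄ := univ) hβ hββ hq hE h
    fun ω _ ω' hω' => ⟨hA inf_le_right hω', trivial⟩
  rwa [fkMeasure_real_univ (hβ.trans hββ) hq, fkMeasure_real_univ hβ hq, one_mul, mul_one]
    at this

theorem IsRandomClusterMeasure.real_closedOn_pos (hP : IsRandomClusterMeasure C β q P)
    (hβ : 0 < β) (hq : 1 ≤ q) (S : Finset (Bond C)) : 0 < P.real (closedOn S) := by
  obtain ⟨W, hW⟩ := exists_subset_bondsIn S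
  refine lt_of_lt_of_le ?_ (hP.le_real W (localOn_closedOn S).measurableSet
    (c := (boxMeasure C β q W fun _ => true).real (closedOn S)) fun η => ?_)
  · refine fkMeasure_real_pos hβ hq (Finset.empty_subset _) fun e he => ?_
    simp [patch, hW he]
  · exact fkMeasure_real_anti hβ.le le_rfl hq (fun e he => mem_bondsIn.1 he)
      (fun e => le_top) (isLowerSet_closedOn S)

theorem localOn_univ : LocalOn (∅ : Finset (Bond C)) univ := fun _ _ _ _ => trivial

/-- The free measure of `Λ` assigns a larger probability to decreasing events. -/
theorem IsRandomClusterMeasure.real_closedOn_le_freeProb (hP : IsRandomClusterMeasure C β q P)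
    (hβ : 0 ≤ β) (hq : 1 ≤ q) (Λ : Finset (Site d)) (S : Finset (Bond C)) :
    P.real (closedOn S) ≤ freeProb C β q Λ (closedOn S) :=
  hP.real_le Λ (localOn_closedOn S).measurableSet fun _ =>
    fkMeasure_real_anti hβ le_rfl hq (fun _ he => mem_bondsIn.1 he) (fun _ => bot_le)
      (isLowerSet_closedOn S)

theorem IsRandomClusterMeasure.real_inter_boundary (hP : IsRandomClusterMeasure C β q P)
    (hβ : 0 ≤ β) (hq : 1 ≤ q) (V : Finset (Site d)) {X : Set (Config C)}
    (hX : LocalOn (bondsIn C V) X) :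
    P.real (X ∩ closedOn (edgeBoundary C V))
      = freeProb C β q V X * P.real (closedOn (edgeBoundary C V)) := by
  have := hP.real_isolated hβ hq V hX localOn_univ (Finset.disjoint_empty_left _)
  rwa [inter_univ] at this

/-- Given that the boundary of Λ is closed, the law inside is free, which favours closing bonds.
Bonds at the boundary of V that do not lie inside Λ belong to the boundary of Λ and are closed
anyway. -/
theorem IsRandomClusterMeasure.boundary_mul_le (hP : IsRandomClusterMeasure C β q P)
    (hβ : 0 ≤ β) (hq : 1 ≤ q) {V Λ : Finset (Site d)} (hV : V ⊆ Λ) :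
    P.real (closedOn (edgeBoundary C V)) * P.real (closedOn (edgeBoundary C Λ))
      ≤ P.real (closedOn (edgeBoundary C V) ∩ closedOn (edgeBoundary C Λ)) := by
  have := hP.1
  set S := edgeBoundary C V ∩ bondsIn C Λ with hS
  have h1 := (hP.real_inter_boundary hβ hq Λ
    ((localOn_closedOn S).mono Finset.inter_subset_right)).ge
  have h2 : P.real (closedOn (edgeBoundary C V)) ≤ freeProb C β q Λ (closedOn S) :=
    (measureReal_mono (closedOn_anti Finset.inter_subset_left)).trans
      (hP.real_closedOn_le_freeProb hβ hq Λ S)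
  refine (mul_le_mul_of_nonneg_right h2 measureReal_nonneg).trans (h1.trans ?_)
  refine measureReal_mono fun ω hω => ⟨fun e he => ?_, hω.2⟩
  by_cases he' : e ∈ bondsIn C Λ
  · exact hω.1 e (Finset.mem_inter.2 ⟨he, he'⟩)
  · exact hω.2 e (Finset.mem_sdiff.2 ⟨bondsAt_mono hV (Finset.mem_sdiff.1 he).1, he'⟩)

/-- Compare P with P conditioned on a closed boundary of Λ, which is the free measure for events
inside Λ. Under both, an isolated pattern of V has the free probability of the pattern times the
probability that the boundary of V is closed. By `boundary_mul_le` the conditioning can only raise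
the latter, so exploration applies. -/
theorem IsRandomClusterMeasure.real_le_freeProb_add (hP : IsRandomClusterMeasure C β q P)
    (hβ : 0 < β) (hq : 1 ≤ q) {W Λ : Finset (Site d)} (hW : W ⊆ Λ) {A : Set (Config C)}
    (hA : LocalOn (bondsIn C W) A) :
    P.real A ≤ freeProb C β q Λ A + P.real (reachOutFrom C W Λ) := by
  have := hP.1
  set B := closedOn (edgeBoundary C Λ) with hB
  have hBm : MeasurableSet B := (localOn_closedOn _).measurableSet
  have hBpos : 0 < P.real B := hP.real_closedOn_pos hβ hq _
  have hcond : ∀ X, (ProbabilityTheory.cond P B).real X = P.real (X ∩ B) / P.real B := by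
    intro X
    rw [Measure.real, ProbabilityTheory.cond_apply hBm, ENNReal.toReal_mul, ENNReal.toReal_inv,
      inter_comm, div_eq_inv_mul]
    rfl
  have key := real_le_of_isolatedPattern_le P (ProbabilityTheory.cond P B) hW ?_ hA
  · rw [hcond, hP.real_inter_boundary hβ.le hq Λ (hA.mono (bondsIn_mono hW)),
      mul_div_cancel_right₀ _ hBpos.ne'] at key
    have := measureReal_mono (μ := P)
      (inter_subset_right : A ∩ reachOutFrom C W Λ ⊆ reachOutFrom C W Λ)
    linarith
  · intro V hV s
    have hdisj : Disjoint (edgeBoundary C Λ) (bondsIn C V) :=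
      Finset.disjoint_of_subset_right (bondsIn_mono hV) Finset.sdiff_disjoint
    rw [hcond, le_div_iff₀ hBpos, isolatedPattern, inter_assoc,
      hP.real_inter_boundary hβ.le hq V (localOn_patternOn V s),
      hP.real_isolated hβ.le hq V (localOn_patternOn V s) (localOn_closedOn _) hdisj, mul_assoc]
    exact mul_le_mul_of_nonneg_left (hP.boundary_mul_le hβ.le hq hV) measureReal_nonneg

theorem freeProb_compl (hβ : 0 ≤ β) (hq : 1 ≤ q) (Λ : Finset (Site d)) {A : Set (Config C)}
    (hA : MeasurableSet A) : freeProb C β q Λ Aᶜ = 1 - freeProb C β q Λ A := by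
  have : IsProbabilityMeasure (boxMeasure C β q Λ fun _ => false) :=
    isProbabilityMeasure_fkMeasure hβ hq
  exact probReal_compl_eq_one_sub hA

/-- The one-sided bound is not restricted to monotone events, so applying it to the complement as
well gives the other side. -/
theorem IsRandomClusterMeasure.abs_real_sub_freeProb_le (hP : IsRandomClusterMeasure C β q P)
    (hβ : 0 < β) (hq : 1 ≤ q) {W Λ : Finset (Site d)} (hW : W ⊆ Λ) {A : Set (Config C)}
    (hA : LocalOn (bondsIn C W) A) :
    |P.real A - freeProb C β q Λ A| ≤ P.real (reachOutFrom C W Λ) := by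
  have := hP.1
  have h1 := hP.real_le_freeProb_add hβ hq hW hA
  have h2 := hP.real_le_freeProb_add hβ hq hW hA.compl
  rw [freeProb_compl hβ.le hq Λ hA.measurableSet, probReal_compl_eq_one_sub hA.measurableSet] at h2
  rw [abs_le]
  constructor <;> linarith

theorem UniformDecay.real_reachOutFrom_le {ν₀ ν₁ : ℝ} [IsFiniteMeasure P]
    (h : UniformDecay P ν₀ ν₁) {W Λ : Finset (Site d)} {n : ℕ} (hn : ∀ x ∈ W, boxAt x n ⊆ Λ) :
    P.real (reachOutFrom C W Λ) ≤ W.card * (ν₀ * Real.exp (-ν₁ * n)) := by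
  refine (measureReal_biUnion_finset_le W _).trans ?_
  rw [← nsmul_eq_mul]
  refine Finset.sum_le_card_nsmul _ _ _ fun x hx => ?_
  exact (measureReal_mono (reachOut_anti x (hn x hx))).trans (h x n)

/-- Local probabilities are limits of probabilities under free measures of large boxes. -/
theorem IsRandomClusterMeasure.tendsto_freeProb (hP : IsRandomClusterMeasure C β q P)
    (hβ : 0 < β) (hq : 1 ≤ q) {ν₀ ν₁ : ℝ} (hν₁ : 0 < ν₁) (hdec : UniformDecay P ν₀ ν₁)
    (v : Site d) {F : Finset (Bond C)} {A : Set (Config C)} (hA : LocalOn F A) :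
    Tendsto (fun N : ℕ => freeProb C β q (boxAt v N) A) atTop (𝓝 (P.real A)) := by
  have := hP.1
  obtain ⟨W, hW⟩ := exists_subset_bondsIn F
  obtain ⟨m, hm⟩ : ∃ m : ℕ, ∀ x ∈ W, ‖x - v‖ ≤ m := by
    refine ⟨W.sup fun x => ⌈‖x - v‖⌉₊, fun x hx => (Nat.le_ceil _).trans ?_⟩
    exact_mod_cast Finset.le_sup (f := fun x => ⌈‖x - v‖⌉₊) hx
  -- W lies within distance m of v, so the box of radius n + m contains a box of radius n around
  -- each point of W.
  rw [← tendsto_add_atTop_iff_nat m, tendsto_iff_norm_sub_tendsto_zero]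
  have hbox : ∀ n : ℕ, ∀ x ∈ W, boxAt x n ⊆ boxAt v (n + m) := by
    intro n x hx y hy
    rw [mem_boxAt] at hy ⊢
    push_cast
    calc ‖y - v‖ = ‖(y - x) + (x - v)‖ := by rw [sub_add_sub_cancel]
      _ ≤ _ := (norm_add_le _ _).trans (add_le_add hy (hm x hx))
  refine squeeze_zero (fun _ => norm_nonneg _) (fun n => ?_)
    (g := fun n : ℕ => W.card * (ν₀ * Real.exp (-ν₁ * n))) ?_
  · rw [Real.norm_eq_abs, abs_sub_comm]
    refine (hP.abs_real_sub_freeProb_le hβ hq (fun x hx => hbox n x hx ?_)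
      (hA.mono hW)).trans (hdec.real_reachOutFrom_le (hbox n))
    rw [mem_boxAt]
    simp
  · have h1 : Tendsto (fun n : ℕ => Real.exp (-ν₁ * n)) atTop (𝓝 0) := by
      refine Real.tendsto_exp_atBot.comp ?_
      exact tendsto_natCast_atTop_atTop.const_mul_atTop_of_neg (by linarith)
    simpa using (h1.const_mul ν₀).const_mul (W.card : ℝ)

/-- The four functions theorem in infinite volume, for indicators of local events. -/
theorem IsRandomClusterMeasure.four_events (hP : IsRandomClusterMeasure C β q P)
    (hβ : 0 < β) (hq : 1 ≤ q) {ν₀ ν₁ : ℝ} (hν₁ : 0 < ν₁) (hdec : UniformDecay P ν₀ ν₁)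
    {F₁ F₂ F₃ F₄ : Finset (Bond C)} {A₁ A₂ A₃ A₄ : Set (Config C)} (h₁ : LocalOn F₁ A₁)
    (h₂ : LocalOn F₂ A₂) (h₃ : LocalOn F₃ A₃) (h₄ : LocalOn F₄ A₄)
    (hA : ∀ ω ∈ A₁, ∀ ω' ∈ A₂, ω ⊓ ω' ∈ A₃ ∧ ω ⊔ ω' ∈ A₄) :
    P.real A₁ * P.real A₂ ≤ P.real A₃ * P.real A₄ := by
  refine le_of_tendsto_of_tendsto'
    ((hP.tendsto_freeProb hβ hq hν₁ hdec 0 h₁).mul (hP.tendsto_freeProb hβ hq hν₁ hdec 0 h₂))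
    ((hP.tendsto_freeProb hβ hq hν₁ hdec 0 h₃).mul (hP.tendsto_freeProb hβ hq hν₁ hdec 0 h₄))
    fun N => ?_
  exact fkMeasure_four_events hβ.le le_rfl hq (fun e he => mem_bondsIn.1 he) le_rfl hA

theorem LocalOn.preimage_shiftConfig {F : Finset (Bond C)} {A : Set (Config C)}
    (hA : LocalOn F A) (v : Site d) :
    LocalOn (F.map (shiftBond C v).toEmbedding) (shiftConfig v ⁻¹' A) := by
  intro ω ω' ha hω
  refine hA _ _ (fun e he => ?_) hω
  exact ha _ (Finset.mem_map_of_mem _ he)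

theorem boxAt_zero (n : ℕ) : boxAt (0 : Site d) n = box d n := by
  ext x; rw [mem_boxAt, mem_box, sub_zero]

/-- Translation invariance. -/
theorem IsRandomClusterMeasure.real_preimage_shiftConfig (hP : IsRandomClusterMeasure C β q P)
    (hβ : 0 < β) (hq : 1 ≤ q) {ν₀ ν₁ : ℝ} (hν₁ : 0 < ν₁) (hdec : UniformDecay P ν₀ ν₁)
    (v : Site d) {F : Finset (Bond C)} {A : Set (Config C)} (hA : LocalOn F A) :
    P.real (shiftConfig v ⁻¹' A) = P.real A := by
  refine tendsto_nhds_unique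
    (hP.tendsto_freeProb hβ hq hν₁ hdec v (hA.preimage_shiftConfig v)) ?_
  refine (hP.tendsto_freeProb hβ hq hν₁ hdec 0 hA).congr fun N => ?_
  rw [boxAt_zero]
  exact (boxMeasure_map_add hβ.le hq v (box d N) (fun _ => false) A).symm

end Uniqueness

/-- The logarithm of the probability that all bonds of `S` are closed. -/
def logClosed (P : Measure (Config C)) (S : Finset (Bond C)) : ℝ := Real.log (P.real (closedOn S))

theorem closedOn_insert (e : Bond C) (S : Finset (Bond C)) :
    closedOn (insert e S) = {ω : Config C | ω e = true}ᶜ ∩ closedOn S := by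
  ext ω
  simp [closedOn]

/-- Random cluster measures with exponential decay of connectivities. -/
structure IsSubcritical (C : Coupling d) (β q ν₀ ν₁ : ℝ) (P : Measure (Config C)) : Prop where
  isRandomCluster : IsRandomClusterMeasure C β q P
  beta_pos : 0 < β
  one_le_q : 1 ≤ q
  prefactor_pos : 0 < ν₀
  rate_pos : 0 < ν₁
  decay : UniformDecay P ν₀ ν₁

/-! ### Mixing estimates for closing bonds. -/

namespace IsSubcritical

variable {β q ν₀ ν₁ : ℝ} {P : Measure (Config C)}

theorem isProbabilityMeasure (h : IsSubcritical C β q ν₀ ν₁ P) : IsProbabilityMeasure P :=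
  h.isRandomCluster.1

theorem real_closedOn_pos (h : IsSubcritical C β q ν₀ ν₁ P) (S : Finset (Bond C)) :
    0 < P.real (closedOn S) :=
  h.isRandomCluster.real_closedOn_pos h.beta_pos h.one_le_q S

theorem four_events (h : IsSubcritical C β q ν₀ ν₁ P)
    {F₁ F₂ F₃ F₄ : Finset (Bond C)} {A₁ A₂ A₃ A₄ : Set (Config C)} (h₁ : LocalOn F₁ A₁)
    (h₂ : LocalOn F₂ A₂) (h₃ : LocalOn F₃ A₃) (h₄ : LocalOn F₄ A₄)
    (hA : ∀ ω ∈ A₁, ∀ ω' ∈ A₂, ω ⊓ ω' ∈ A₃ ∧ ω ⊔ ω' ∈ A₄) :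
    P.real A₁ * P.real A₂ ≤ P.real A₃ * P.real A₄ :=
  h.isRandomCluster.four_events h.beta_pos h.one_le_q h.rate_pos h.decay h₁ h₂ h₃ h₄ hA

theorem real_preimage_shiftConfig (h : IsSubcritical C β q ν₀ ν₁ P) (v : Site d)
    {F : Finset (Bond C)} {A : Set (Config C)} (hA : LocalOn F A) :
    P.real (shiftConfig v ⁻¹' A) = P.real A :=
  h.isRandomCluster.real_preimage_shiftConfig h.beta_pos h.one_le_q h.rate_pos h.decay v hA

/-- Closing bonds satisfies the lattice condition. -/
theorem closedOn_mul_le (h : IsSubcritical C β q ν₀ ν₁ P) (S E T : Finset (Bond C)) :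
    P.real (closedOn (S ∪ T)) * P.real (closedOn (S ∪ E))
      ≤ P.real (closedOn (S ∪ E ∪ T)) * P.real (closedOn S) := by
  refine h.four_events (localOn_closedOn _) (localOn_closedOn _) (localOn_closedOn _)
    (localOn_closedOn _) fun ω hω ω' hω' => ⟨?_, ?_⟩
  · rw [closedOn_union] at hω ⊢
    exact ⟨isLowerSet_closedOn _ inf_le_right hω', isLowerSet_closedOn _ inf_le_left hω.2⟩
  · rw [closedOn_union] at hω hω'
    exact sup_mem_closedOn hω.1 hω'.1

theorem real_inter_closedOn_le (h : IsSubcritical C β q ν₀ ν₁ P) {F : Finset (Bond C)}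
    {U : Set (Config C)} (hU : LocalOn F U) (hU' : IsUpperSet U) (S : Finset (Bond C)) :
    P.real (U ∩ closedOn S) ≤ P.real U * P.real (closedOn S) := by
  have := h.isProbabilityMeasure
  have key := h.four_events (hU.inter (localOn_closedOn S)) localOn_univ (localOn_closedOn S) hU
    fun ω hω ω' _ => ⟨isLowerSet_closedOn S inf_le_left hω.2, hU' le_sup_left hω.1⟩
  rwa [probReal_univ, mul_one, mul_comm] at key

theorem isolatedPattern_inter_le (h : IsSubcritical C β q ν₀ ν₁ P) {S E : Finset (Bond C)}
    {V : Finset (Site d)} (hE : Disjoint E (bondsIn C V)) (s : Finset (Bond C)) :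
    P.real (isolatedPattern V s ∩ closedOn S) * P.real (closedOn (S ∪ E))
      ≤ P.real (isolatedPattern V s ∩ closedOn (S ∪ E)) * P.real (closedOn S) := by
  have hP := h.isRandomCluster
  have hβ := h.beta_pos.le
  have hq := h.one_le_q
  set S₁ := S ∩ bondsIn C V with hS₁
  set S₂ := S \ bondsIn C V with hS₂
  have hS : S = S₁ ∪ S₂ := by
    rw [hS₁, hS₂, Finset.union_comm, Finset.sdiff_union_inter]
  have hd₂ : Disjoint S₂ (bondsIn C V) := Finset.sdiff_disjoint
  have hX : LocalOn (bondsIn C V) (patternOn V s ∩ closedOn S₁) :=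
    ((localOn_patternOn V s).inter (localOn_closedOn S₁)).mono
      (Finset.union_subset (Finset.Subset.refl _) Finset.inter_subset_right)
  have h1 := hP.real_isolated hβ hq V hX (localOn_closedOn S₂) hd₂
  have h2 := hP.real_isolated hβ hq V hX (localOn_closedOn (S₂ ∪ E))
    (Finset.disjoint_union_left.2 ⟨hd₂, hE⟩)
  -- The reference pattern: with every bond inside V closed, all events in question have the form
  -- `closedOn`.
  have h3 := hP.real_isolated hβ hq V (localOn_closedOn (bondsIn C V)) (localOn_closedOn S₂) hd₂
  have h4 := hP.real_isolated hβ hq V (localOn_closedOn (bondsIn C V))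
    (localOn_closedOn (S₂ ∪ E)) (Finset.disjoint_union_left.2 ⟨hd₂, hE⟩)
  have e1 : isolatedPattern V s ∩ closedOn S
      = patternOn V s ∩ closedOn S₁ ∩ (closedOn (edgeBoundary C V) ∩ closedOn S₂) := by
    rw [hS, closedOn_union, isolatedPattern]
    ext ω; simp only [mem_inter_iff]; tauto
  have e2 : isolatedPattern V s ∩ closedOn (S ∪ E)
      = patternOn V s ∩ closedOn S₁ ∩ (closedOn (edgeBoundary C V) ∩ closedOn (S₂ ∪ E)) := by
    rw [hS, closedOn_union, closedOn_union, closedOn_union, isolatedPattern]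
    ext ω; simp only [mem_inter_iff]; tauto
  have hat : bondsAt C V = bondsIn C V ∪ edgeBoundary C V := by
    rw [edgeBoundary, Finset.union_sdiff_of_subset (bondsIn_subset_bondsAt V)]
  have hsub : closedOn (bondsIn C V) ⊆ closedOn S₁ := closedOn_anti Finset.inter_subset_right
  have e3 : closedOn (bondsIn C V) ∩ (closedOn (edgeBoundary C V) ∩ closedOn S₂)
      = closedOn (S ∪ bondsAt C V) := by
    rw [hat, hS, closedOn_union, closedOn_union, closedOn_union]
    ext ω
    have := @hsub ω
    simp only [mem_inter_iff]; tauto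
  have e4 : closedOn (bondsIn C V) ∩ (closedOn (edgeBoundary C V) ∩ closedOn (S₂ ∪ E))
      = closedOn (S ∪ E ∪ bondsAt C V) := by
    rw [hat, hS, closedOn_union, closedOn_union, closedOn_union, closedOn_union, closedOn_union]
    ext ω
    have := @hsub ω
    simp only [mem_inter_iff]; tauto
  rw [e3] at h3
  rw [e4] at h4
  rw [e1, e2, h1, h2]
  have key := h.closedOn_mul_le S E (bondsAt C V)
  rw [h3, h4] at key
  have hf : 0 < freeProb C β q V (closedOn (bondsIn C V)) := by
    refine fkMeasure_real_pos h.beta_pos hq (Finset.empty_subset _) fun e he => ?_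
    simp [patch, he]
  rw [mul_assoc, mul_assoc] at key ⊢
  exact mul_le_mul_of_nonneg_left (le_of_mul_le_mul_left key hf) measureReal_nonneg

/-- Closing distant bonds hardly affects the probability that a bond is closed. -/
theorem closedOn_insert_div_le (h : IsSubcritical C β q ν₀ ν₁ P) {S E : Finset (Bond C)}
    {Λ : Finset (Site d)} {e : Bond C} {x : Site d} (hx : x ∈ e.1) (he : e ∈ bondsIn C Λ)
    (hE : Disjoint E (bondsAt C Λ)) :
    P.real (closedOn (insert e (S ∪ E))) / P.real (closedOn (S ∪ E))
      ≤ P.real (closedOn (insert e S)) / P.real (closedOn S) + P.real (reachOut C x Λ) := by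
  have := h.isProbabilityMeasure
  have hm : ∀ S : Finset (Bond C), MeasurableSet (closedOn S) :=
    fun S => (localOn_closedOn S).measurableSet
  have hcond : ∀ (T : Finset (Bond C)) X,
      (ProbabilityTheory.cond P (closedOn T)).real X
        = P.real (X ∩ closedOn T) / P.real (closedOn T) := by
    intro T X
    rw [Measure.real, ProbabilityTheory.cond_apply (hm T), ENNReal.toReal_mul,
      ENNReal.toReal_inv, inter_comm, div_eq_inv_mul]
    rfl
  set A : Set (Config C) := {ω | ω e = true} with hA
  set W := e.1.toFinset with hW
  have hWΛ : W ⊆ Λ := fun y hy => mem_bondsIn.1 he y (Sym2.mem_toFinset.1 hy)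
  have hAl : LocalOn (bondsIn C W) A := fun ω ω' ha hω =>
    (ha e (mem_bondsIn.2 fun y hy => Sym2.mem_toFinset.2 hy)).symm.trans hω
  have key := real_le_of_isolatedPattern_le (ProbabilityTheory.cond P (closedOn S))
    (ProbabilityTheory.cond P (closedOn (S ∪ E))) hWΛ ?_ hAl
  · have hsub : A ∩ reachOutFrom C W Λ ⊆ reachOut C x Λ := by
      rintro ω ⟨hω, hr⟩
      rw [reachOutFrom, mem_iUnion₂] at hr
      obtain ⟨y, hy, z, hz, hyz⟩ := hr
      rw [Sym2.mem_toFinset] at hy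
      refine ⟨z, hz, ?_⟩
      by_cases hxy : x = y
      · rwa [hxy]
      · have hexy := (Sym2.mem_and_mem_iff hxy).1 ⟨hx, hy⟩
        refine (SimpleGraph.Adj.reachable ?_).trans hyz
        rw [openGraph_adj]
        exact ⟨hexy ▸ e.2, by rw [← show ω e = true from hω]; congr; exact hexy.symm⟩
    have h1 : (ProbabilityTheory.cond P (closedOn S)).real (A ∩ reachOutFrom C W Λ)
        ≤ P.real (reachOut C x Λ) := by
      rw [hcond, div_le_iff₀ (h.real_closedOn_pos S)]
      exact (measureReal_mono (inter_subset_inter_left _ hsub)).trans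
        (h.real_inter_closedOn_le (localOn_reachOut x Λ) (isUpperSet_reachOut x Λ) S)
    have h2 : ∀ T : Finset (Bond C), P.real (closedOn (insert e T)) / P.real (closedOn T)
        = 1 - (ProbabilityTheory.cond P (closedOn T)).real A := by
      intro T
      rw [hcond, closedOn_insert, eq_sub_iff_add_eq, ← add_div, add_comm,
        div_eq_one_iff_eq (h.real_closedOn_pos T).ne', ← hA, inter_comm, inter_comm Aᶜ]
      exact measureReal_inter_add_sdiff hAl.measurableSet
    rw [h2, h2]
    linarith
  · intro V hV s
    have hEV : Disjoint E (bondsIn C V) := Finset.disjoint_of_subset_right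
      ((bondsIn_subset_bondsAt V).trans (bondsAt_mono hV)) hE
    rw [hcond, hcond, div_le_div_iff₀ (h.real_closedOn_pos _) (h.real_closedOn_pos _)]
    exact h.isolatedPattern_inter_le hEV s

/-- A uniform lower bound for the probability that a bond is closed. -/
theorem exists_le_real_closedOn_singleton (h : IsSubcritical C β q ν₀ ν₁ P) :
    ∃ c : ℝ, 0 < c ∧ ∀ e : Bond C, c ≤ P.real (closedOn {e}) := by
  -- Finitely many bonds touch the origin, and every bond is a translate of one of them.
  obtain ⟨c, hc, hle⟩ : ∃ c : ℝ, 0 < c ∧ ∀ e ∈ bondsAt C {0}, c ≤ P.real (closedOn {e}) := by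
    rcases (bondsAt C {0}).eq_empty_or_nonempty with h0 | h0
    · exact ⟨1, one_pos, by simp [h0]⟩
    · obtain ⟨e₀, -, hmin⟩ :=
        (bondsAt C {0}).exists_min_image (fun e => P.real (closedOn {e})) h0
      exact ⟨_, h.real_closedOn_pos {e₀}, hmin⟩
  refine ⟨c, hc, fun e => ?_⟩
  obtain ⟨x, hx⟩ : ∃ x, x ∈ e.1 := ⟨_, Sym2.out_fst_mem e.1⟩
  set e' := (shiftBond C x).symm e with he'
  have hee : shiftBond C x e' = e := (shiftBond C x).apply_symm_apply e
  have h0 : (0 : Site d) ∈ e'.1 := by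
    rw [← mem_shiftBond (v := x), add_zero, hee]
    exact hx
  have h1 := hle e' (mem_bondsAt.2 ⟨0, by simp, h0⟩)
  rw [← h.real_preimage_shiftConfig x (localOn_closedOn {e'})] at h1
  convert! h1 using 2
  ext ω
  simp [closedOn, shiftConfig, hee]

/-- The effect on `logClosed` of closing a single bond depends little on distant bonds. -/
theorem exists_logClosed_insert_bounds (h : IsSubcritical C β q ν₀ ν₁ P) :
    ∃ K : ℝ, 0 < K ∧ ∀ (S E : Finset (Bond C)) (e : Bond C) (x : Site d) (m : ℝ), x ∈ e.1 →
      (∀ e' ∈ E, ∀ y ∈ e'.1, m ≤ ‖y - x‖) →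
      0 ≤ logClosed P (insert e (S ∪ E)) - logClosed P (S ∪ E)
        - logClosed P (insert e S) + logClosed P S ∧
      logClosed P (insert e (S ∪ E)) - logClosed P (S ∪ E)
        - logClosed P (insert e S) + logClosed P S ≤ K * Real.exp (-ν₁ * m) := by
  have := h.isProbabilityMeasure
  obtain ⟨c, hc, hle⟩ := h.exists_le_real_closedOn_singleton
  have hν₁ := h.rate_pos
  have hν₀ := h.prefactor_pos
  -- The first term covers large m, with exp ν₁ paid for rounding m to an integer radius. The second
  -- makes the bound trivial for m ≤ R + 1.
  set K := (ν₀ * Real.exp ν₁ + Real.exp (ν₁ * (C.R + 1))) / c with hK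
  refine ⟨K, by positivity, fun S E e x m hx hm => ?_⟩
  have hp := h.real_closedOn_pos
  set r := P.real (closedOn (insert e S)) / P.real (closedOn S) with hr
  set r' := P.real (closedOn (insert e (S ∪ E))) / P.real (closedOn (S ∪ E)) with hr'
  have hrpos : 0 < r := div_pos (hp _) (hp _)
  have hrpos' : 0 < r' := div_pos (hp _) (hp _)
  have hrw : logClosed P (insert e (S ∪ E)) - logClosed P (S ∪ E)
        - logClosed P (insert e S) + logClosed P S = Real.log (r' / r) := by
    rw [Real.log_div hrpos'.ne' hrpos.ne', hr, hr', Real.log_div (hp _).ne' (hp _).ne',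
      Real.log_div (hp _).ne' (hp _).ne']
    simp only [logClosed]
    ring
  rw [hrw]
  have hins : ∀ T : Finset (Bond C), insert e T = T ∪ {e} := fun T => by
    rw [Finset.union_comm]; rfl
  have hrr : r ≤ r' := by
    rw [hr, hr', div_le_div_iff₀ (hp _) (hp _), hins, hins]
    exact h.closedOn_mul_le S E {e}
  -- Conditioning on closed bonds only helps e to be closed, so the unconditional lower bound
  -- applies.
  have hcr : c ≤ r := by
    refine (hle e).trans ?_
    have := h.closedOn_mul_le ∅ S {e}
    rw [closedOn_empty, probReal_univ, mul_one, Finset.empty_union, Finset.empty_union,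
      ← hins] at this
    rwa [hr, le_div_iff₀ (hp _)]
  have hr1 : r' ≤ 1 := by
    rw [hr', div_le_one (hp _)]
    exact measureReal_mono (closedOn_anti (Finset.subset_insert _ _))
  refine ⟨Real.log_nonneg ((one_le_div hrpos).2 hrr), ?_⟩
  have hlog : Real.log (r' / r) ≤ (r' - r) / c := by
    refine (Real.log_le_sub_one_of_pos (div_pos hrpos' hrpos)).trans ?_
    rw [div_sub_one hrpos.ne']
    exact div_le_div_of_nonneg_left (sub_nonneg.2 hrr) hc hcr
  refine hlog.trans ?_
  rw [hK, div_mul_eq_mul_div]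
  refine div_le_div_of_nonneg_right ?_ hc.le
  rw [add_mul, mul_assoc, ← Real.exp_add, ← Real.exp_add]
  rcases le_or_gt m (C.R + 1) with hmR | hmR
  · have h1 : (1 : ℝ) ≤ Real.exp (ν₁ * (C.R + 1) + -ν₁ * m) :=
      Real.one_le_exp (by nlinarith)
    have h2 : 0 ≤ ν₀ * Real.exp (ν₁ + -ν₁ * m) := by positivity
    linarith
  · have hm0 : 0 < m := by linarith [C.R_pos]
    -- The radius is strictly below m, to keep E off the box, and at least m - 1 > R, to keep e
    -- inside it.
    set n := ⌈m⌉₊ - 1 with hn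
    have hceil : 1 ≤ ⌈m⌉₊ := Nat.one_le_iff_ne_zero.2 (Nat.ceil_pos.2 hm0).ne'
    have hncast : (n : ℝ) = (⌈m⌉₊ : ℝ) - 1 := by rw [hn, Nat.cast_sub hceil, Nat.cast_one]
    have hn1 : m - 1 ≤ n := by linarith [Nat.le_ceil m]
    have hn2 : (n : ℝ) < m := by linarith [Nat.ceil_lt_add_one hm0.le]
    have he : e ∈ bondsIn C (boxAt x n) := mem_bondsIn.2 fun y hy => mem_boxAt.2 <|
      (norm_sub_le_of_mem_bond e hx hy).trans (by linarith)
    have hE : Disjoint E (bondsAt C (boxAt x n)) := by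
      refine Finset.disjoint_left.2 fun e' he' hat => ?_
      obtain ⟨y, hy, hye⟩ := mem_bondsAt.1 hat
      have := hm e' he' y hye
      rw [mem_boxAt] at hy
      linarith
    have h1 := h.closedOn_insert_div_le (S := S) hx he hE
    have h2 := h.decay x n
    have h3 : Real.exp (-ν₁ * n) ≤ Real.exp (ν₁ + -ν₁ * m) :=
      Real.exp_le_exp.2 (by nlinarith)
    have h4 := mul_le_mul_of_nonneg_left h3 hν₀.le
    have h5 := Real.exp_pos (ν₁ * (C.R + 1) + -ν₁ * m)
    rw [← hr, ← hr'] at h1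
    linarith

/-- The effect on `logClosed` of closing the bonds of `D` depends little on distant bonds. -/
theorem exists_logClosed_union_bounds (h : IsSubcritical C β q ν₀ ν₁ P) :
    ∃ K : ℝ, 0 < K ∧ ∀ (D S E : Finset (Bond C)) (x : Bond C → Site d) (m : Bond C → ℝ),
      (∀ e ∈ D, x e ∈ e.1 ∧ ∀ e' ∈ E, ∀ y ∈ e'.1, m e ≤ ‖y - x e‖) →
      0 ≤ logClosed P (D ∪ (S ∪ E)) - logClosed P (S ∪ E)
        - logClosed P (D ∪ S) + logClosed P S ∧
      logClosed P (D ∪ (S ∪ E)) - logClosed P (S ∪ E)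
        - logClosed P (D ∪ S) + logClosed P S ≤ K * ∑ e ∈ D, Real.exp (-ν₁ * m e) := by
  obtain ⟨K, hK, hb⟩ := h.exists_logClosed_insert_bounds
  refine ⟨K, hK, fun D S E x m => ?_⟩
  induction D using Finset.induction_on with
  | empty => intro _; simp
  | insert e D he ih =>
    intro hD
    obtain ⟨h1, h2⟩ := ih fun e' he' => hD e' (Finset.mem_insert_of_mem he')
    -- The bonds closed earlier join the background, which is arbitrary in the one-bond estimate, so
    -- the second differences telescope.
    obtain ⟨h3, h4⟩ := hb (D ∪ S) E e (x e) (m e) (hD e (Finset.mem_insert_self _ _)).1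
      (hD e (Finset.mem_insert_self _ _)).2
    rw [Finset.union_assoc] at h3 h4
    rw [Finset.insert_union, Finset.insert_union, Finset.sum_insert he, mul_add]
    constructor <;> linarith

end IsSubcritical

/-! ### Connection probabilities and the inverse correlation length. -/

section Connections

/-- The configuration with all bonds outside `Λ` closed. -/
def truncate (Λ : Finset (Site d)) (ω : Config C) : Config C :=
  fun e => if e ∈ bondsIn C Λ then ω e else false

theorem truncate_mono {Λ Λ' : Finset (Site d)} (h : Λ ⊆ Λ') {ω ω' : Config C} (hω : ω ≤ ω') :
    truncate Λ ω ≤ truncate Λ' ω' := by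
  intro e
  by_cases he : e ∈ bondsIn C Λ
  · simpa only [truncate, he, bondsIn_mono h he, if_true] using hω e
  · simp only [truncate, he, if_false]
    exact bot_le

theorem truncate_le (Λ : Finset (Site d)) (ω : Config C) : truncate Λ ω ≤ ω := by
  intro e
  by_cases he : e ∈ bondsIn C Λ
  · simp only [truncate, he, if_true]
    exact le_rfl
  · simp only [truncate, he, if_false]
    exact bot_le

/-- The event that `x` and `y` are connected by open bonds inside `Λ`. -/
def connectedIn (C : Coupling d) (Λ : Finset (Site d)) (x y : Site d) : Set (Config C) :=
  {ω | (openGraph (truncate Λ ω)).Reachable x y}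

theorem localOn_connectedIn (Λ : Finset (Site d)) (x y : Site d) :
    LocalOn (bondsIn C Λ) (connectedIn C Λ x y) := by
  intro ω ω' ha hω
  have : truncate Λ ω = truncate Λ ω' := by
    funext e
    by_cases he : e ∈ bondsIn C Λ
    · simp only [truncate, he, if_true, ha e he]
    · simp only [truncate, he, if_false]
  change (openGraph (truncate Λ ω')).Reachable x y
  rw [← this]
  exact hω

theorem isUpperSet_connectedIn (Λ : Finset (Site d)) (x y : Site d) :
    IsUpperSet (connectedIn C Λ x y) := fun _ _ h hω =>
  SimpleGraph.Reachable.mono (openGraph_mono (truncate_mono (Finset.Subset.refl Λ) h)) hω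

theorem connectedIn_mono {Λ Λ' : Finset (Site d)} (h : Λ ⊆ Λ') (x y : Site d) :
    connectedIn C Λ x y ⊆ connectedIn C Λ' x y := fun _ hω =>
  SimpleGraph.Reachable.mono (openGraph_mono (truncate_mono h le_rfl)) hω

theorem box_mono : Monotone (box d) := fun m n h x hx => by
  rw [mem_box] at hx ⊢
  exact hx.trans (by exact_mod_cast h)

/-- Connection is not a local event, while FKG and translation invariance are known for local ones.
Since open paths are finite, connection is the increasing limit of its versions inside boxes. -/
theorem iUnion_connectedIn (x y : Site d) :
    ⋃ N : ℕ, connectedIn C (box d N) x y = connected C x y := by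
  ext ω
  rw [mem_iUnion]
  constructor
  · rintro ⟨N, hN⟩
    exact SimpleGraph.Reachable.mono (openGraph_mono (truncate_le _ _)) hN
  · intro h
    have h := (SimpleGraph.reachable_iff_reflTransGen _ _).1 h
    induction h with
    | refl => exact ⟨0, .refl _⟩
    | @tail a b hxa hab ih =>
      obtain ⟨N, hN⟩ := ih ((SimpleGraph.reachable_iff_reflTransGen _ _).2 hxa)
      obtain ⟨he, ho⟩ := openGraph_adj.1 hab
      set n := ⌈‖a‖⌉₊ ⊔ ⌈‖b‖⌉₊ with hn
      have hin : (⟨s(a, b), he⟩ : Bond C) ∈ bondsIn C (box d (N ⊔ n)) := by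
        rw [mem_bondsIn]
        intro z hz
        refine box_mono le_sup_right (mem_box.2 ?_)
        rcases Sym2.mem_iff.1 hz with rfl | rfl
        · exact (Nat.le_ceil _).trans (by exact_mod_cast le_sup_left)
        · exact (Nat.le_ceil _).trans (by exact_mod_cast le_sup_right)
      refine ⟨N ⊔ n, SimpleGraph.Reachable.trans (connectedIn_mono (box_mono le_sup_left) _ _ hN)
        (SimpleGraph.Adj.reachable (openGraph_adj.2 ⟨he, ?_⟩))⟩
      simp only [truncate, hin, if_true, ho]

theorem tendsto_real_iUnion (μ : Measure (Config C)) [IsFiniteMeasure μ]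
    {A : ℕ → Set (Config C)} (hA : Monotone A) :
    Tendsto (fun N => μ.real (A N)) atTop (𝓝 (μ.real (⋃ N, A N))) :=
  (ENNReal.tendsto_toReal (measure_ne_top _ _)).comp (tendsto_measure_iUnion_atTop hA)

theorem preimage_shiftConfig_connected (v x y : Site d) :
    shiftConfig v ⁻¹' connected C x y = connected C (v + x) (v + y) := by
  ext ω
  exact (reachable_shiftConfig v ω x y).symm

end Connections

namespace IsSubcritical

variable {β q ν₀ ν₁ : ℝ} {P : Measure (Config C)}

theorem tendsto_connectedIn (h : IsSubcritical C β q ν₀ ν₁ P) (x y : Site d) :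
    Tendsto (fun N : ℕ => P.real (connectedIn C (box d N) x y)) atTop
      (𝓝 (P.real (connected C x y))) := by
  have := h.isProbabilityMeasure
  rw [← iUnion_connectedIn]
  exact tendsto_real_iUnion P fun m n hmn => connectedIn_mono (box_mono hmn) x y

theorem real_connected_add (h : IsSubcritical C β q ν₀ ν₁ P) (v x y : Site d) :
    P.real (connected C (v + x) (v + y)) = P.real (connected C x y) := by
  have := h.isProbabilityMeasure
  refine tendsto_nhds_unique ?_ (h.tendsto_connectedIn x y)
  rw [← preimage_shiftConfig_connected, ← iUnion_connectedIn, preimage_iUnion]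
  refine (tendsto_real_iUnion P fun m n hmn => preimage_mono
    (connectedIn_mono (box_mono hmn) x y)).congr fun N => ?_
  exact h.real_preimage_shiftConfig v (localOn_connectedIn _ x y)

theorem connected_mul_le (h : IsSubcritical C β q ν₀ ν₁ P) (x y : Site d) :
    P.real (connected C 0 x) * P.real (connected C 0 y) ≤ P.real (connected C 0 (x + y)) := by
  have := h.isProbabilityMeasure
  have h1 := h.real_connected_add x 0 y
  rw [add_zero] at h1
  rw [← h1]
  refine le_of_tendsto' ((h.tendsto_connectedIn 0 x).mul (h.tendsto_connectedIn x (x + y)))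
    fun N => ?_
  have key := h.four_events (localOn_connectedIn (box d N) 0 x)
    (localOn_connectedIn (box d N) x (x + y)) localOn_univ
    ((localOn_connectedIn (box d N) 0 x).inter (localOn_connectedIn (box d N) x (x + y)))
    fun ω hω ω' hω' => ⟨trivial, isUpperSet_connectedIn _ _ _ le_sup_left hω,
      isUpperSet_connectedIn _ _ _ le_sup_right hω'⟩
  rw [probReal_univ, one_mul] at key
  refine key.trans (measureReal_mono fun ω hω => ?_)
  rw [← iUnion_connectedIn]
  exact mem_iUnion.2 ⟨N, SimpleGraph.Reachable.trans hω.1 hω.2⟩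

theorem real_connected_pos_of_bond (h : IsSubcritical C β q ν₀ ν₁ P) {x : Site d}
    (hx : s(0, x) ∈ (bondGraph C).edgeSet) : 0 < P.real (connected C 0 x) := by
  have := h.isProbabilityMeasure
  set e : Bond C := ⟨s(0, x), hx⟩ with he
  set A : Set (Config C) := {ω | ω e = true} with hA
  have hAl : LocalOn {e} A := fun ω ω' ha hω => (ha e (by simp)).symm.trans hω
  have hAu : IsUpperSet A := fun ω ω' hle hω => by
    have h' := hle e
    rw [show ω e = true from hω] at h'
    exact top_le_iff.1 h'
  obtain ⟨W, hW⟩ := exists_subset_bondsIn {e}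
  have h1 : 0 < freeProb C β q W A :=
    fkMeasure_real_pos h.beta_pos h.one_le_q (Finset.Subset.refl _) (by
      simp [hA, patch, hW (Finset.mem_singleton_self e)])
  refine h1.trans_le ((h.isRandomCluster.le_real W hAl.measurableSet fun η =>
    fkMeasure_real_mono h.beta_pos.le le_rfl h.one_le_q (fun e he => mem_bondsIn.1 he)
      (fun e => bot_le) hAu).trans (measureReal_mono fun ω hω => ?_))
  exact SimpleGraph.Adj.reachable (openGraph_adj.2 ⟨hx, hω⟩)

theorem real_connected_self (h : IsSubcritical C β q ν₀ ν₁ P) (x : Site d) :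
    P.real (connected C x x) = 1 := by
  have := h.isProbabilityMeasure
  have : connected C x x = univ := eq_univ_of_forall fun ω => SimpleGraph.Reachable.refl _
  rw [this, probReal_univ]

theorem single_mem_edgeSet (i : Fin d) {k : ℤ} (hk : |k| = 1) :
    s(0, Pi.single i k) ∈ (bondGraph C).edgeSet := by
  have hk0 : k ≠ 0 := by rintro rfl; simp at hk
  rw [mem_edgeSet_bondGraph, sub_zero]
  refine ⟨fun h => hk0 ?_, C.nearest_pos _ ?_⟩
  · simpa using (congrFun h i).symm
  · have : toEucl (Pi.single i k : Site d) = EuclideanSpace.single i (k : ℝ) := by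
      ext j
      rw [toEucl_apply]
      by_cases hj : j = i
      · subst hj; simp
      · simp [hj]
    rw [this, PiLp.norm_single, Real.norm_eq_abs]
    exact_mod_cast hk

/-- Connection probabilities decay at most exponentially. -/
theorem exists_exp_le_real_connected (h : IsSubcritical C β q ν₀ ν₁ P) :
    ∃ M : ℝ, 0 < M ∧ ∀ x : Site d,
      Real.exp (-(M * ∑ i, |(x i : ℝ)|)) ≤ P.real (connected C 0 x) := by
  have := h.isProbabilityMeasure
  have hpos : ∀ (i : Fin d) (k : ℤ), |k| = 1 → 0 < P.real (connected C 0 (Pi.single i k)) :=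
    fun i k hk => h.real_connected_pos_of_bond (single_mem_edgeSet i hk)
  -- Nearest-neighbour connections have positive probability, and there are finitely many, so one
  -- rate M serves every unit step. FKG then multiplies along a walk parallel to the axes.
  set b : Fin d → ℝ := fun i => |Real.log (P.real (connected C 0 (Pi.single i 1)))|
    + |Real.log (P.real (connected C 0 (Pi.single i (-1))))| with hb
  have hb0 : ∀ i, 0 ≤ b i := fun i => by positivity
  set M := 1 + ∑ i, b i with hM
  have hMb : ∀ i, b i ≤ M := fun i => by
    have := Finset.single_le_sum (fun i _ => hb0 i) (Finset.mem_univ i)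
    linarith
  have hM0 : 0 < M := by
    have := Finset.sum_nonneg fun i (_ : i ∈ Finset.univ) => hb0 i
    linarith
  have hunit : ∀ i (k : ℤ), k = 1 ∨ k = -1 →
      Real.exp (-M) ≤ P.real (connected C 0 (Pi.single i k)) := by
    intro i k hk
    have hk1 : |k| = 1 := by rcases hk with rfl | rfl <;> simp
    rw [← Real.le_log_iff_exp_le (hpos i k hk1)]
    have h1 : |Real.log (P.real (connected C 0 (Pi.single i k)))| ≤ b i := by
      rcases hk with rfl | rfl
      · exact le_add_of_nonneg_right (abs_nonneg _)
      · exact le_add_of_nonneg_left (abs_nonneg _)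
    have h2 := neg_abs_le (Real.log (P.real (connected C 0 (Pi.single i k))))
    linarith [hMb i]
  have hnat : ∀ i (k : ℤ), k = 1 ∨ k = -1 → ∀ n : ℕ,
      Real.exp (-(M * n)) ≤ P.real (connected C 0 (Pi.single i (n * k))) := by
    intro i k hk n
    induction n with
    | zero => simp [h.real_connected_self]
    | succ n ih =>
      have h1 := h.connected_mul_le (Pi.single i (n * k)) (Pi.single i k)
      rw [← Pi.single_add] at h1
      have h2 : ((n + 1 : ℕ) : ℤ) * k = n * k + k := by push_cast; ring
      rw [h2]
      refine le_trans (le_of_eq ?_) ((mul_le_mul ih (hunit i k hk) (Real.exp_pos _).le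
        measureReal_nonneg).trans h1)
      rw [← Real.exp_add]
      push_cast
      ring_nf
  have hint : ∀ i (k : ℤ),
      Real.exp (-(M * |(k : ℝ)|)) ≤ P.real (connected C 0 (Pi.single i k)) := by
    intro i k
    have habs : |(k : ℝ)| = (k.natAbs : ℝ) := by
      rw [Nat.cast_natAbs, Int.cast_abs]
    rw [habs]
    rcases Int.natAbs_eq k with hk | hk
    · have := hnat i 1 (Or.inl rfl) k.natAbs
      rwa [mul_one, ← hk] at this
    · have := hnat i (-1) (Or.inr rfl) k.natAbs
      rwa [mul_neg_one, ← hk] at this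
  refine ⟨M, hM0, fun x => ?_⟩
  have hsum : ∀ s : Finset (Fin d), Real.exp (-(M * ∑ i ∈ s, |(x i : ℝ)|))
      ≤ P.real (connected C 0 (∑ i ∈ s, Pi.single i (x i))) := by
    intro s
    induction s using Finset.induction_on with
    | empty => simp [h.real_connected_self]
    | insert i s hi ih =>
      rw [Finset.sum_insert hi, Finset.sum_insert hi]
      refine le_trans (le_of_eq ?_) ((mul_le_mul (hint i (x i)) ih (Real.exp_pos _).le
        measureReal_nonneg).trans (h.connected_mul_le _ _))
      rw [← Real.exp_add]
      ring_nf
  have := hsum Finset.univ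
  rwa [Finset.univ_sum_single] at this

theorem real_connected_pos (h : IsSubcritical C β q ν₀ ν₁ P) (x : Site d) :
    0 < P.real (connected C 0 x) := by
  obtain ⟨M, -, hM⟩ := h.exists_exp_le_real_connected
  exact (Real.exp_pos _).trans_le (hM x)

theorem neg_log_connected_add_le (h : IsSubcritical C β q ν₀ ν₁ P) (x y : Site d) :
    -Real.log (P.real (connected C 0 (x + y)))
      ≤ -Real.log (P.real (connected C 0 x)) + -Real.log (P.real (connected C 0 y)) := by
  have h1 := Real.log_le_log (mul_pos (h.real_connected_pos x) (h.real_connected_pos y))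
    (h.connected_mul_le x y)
  rw [Real.log_mul (h.real_connected_pos x).ne' (h.real_connected_pos y).ne'] at h1
  linarith

theorem exists_le_neg_log_connected (h : IsSubcritical C β q ν₀ ν₁ P) :
    ∃ K : ℝ, 0 ≤ K ∧ ∀ y : Site d,
      ν₁ * ‖y‖ - K ≤ -Real.log (P.real (connected C 0 y)) := by
  have := h.isProbabilityMeasure
  refine ⟨|Real.log ν₀| + ν₁, add_nonneg (abs_nonneg _) h.rate_pos.le, fun y => ?_⟩
  rcases (norm_nonneg y).eq_or_lt with hy | hy
  · rw [← hy]
    have h1 : Real.log (P.real (connected C 0 y)) ≤ 0 :=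
      Real.log_nonpos measureReal_nonneg measureReal_le_one
    have h2 := abs_nonneg (Real.log ν₀)
    have h3 := h.rate_pos
    linarith
  · have hceil : 1 ≤ ⌈‖y‖⌉₊ := Nat.one_le_iff_ne_zero.2 (Nat.ceil_pos.2 hy).ne'
    set n := ⌈‖y‖⌉₊ - 1 with hn
    have hncast : (n : ℝ) = (⌈‖y‖⌉₊ : ℝ) - 1 := by rw [hn, Nat.cast_sub hceil, Nat.cast_one]
    have hn1 : ‖y‖ - 1 ≤ n := by linarith [Nat.le_ceil ‖y‖]
    have hn2 : (n : ℝ) < ‖y‖ := by linarith [Nat.ceil_lt_add_one hy.le]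
    have hsub : connected C 0 y ⊆ reachOut C 0 (boxAt 0 n) := fun ω hω =>
      ⟨y, by rw [mem_boxAt, sub_zero]; exact not_le.2 hn2, hω⟩
    have h1 := (measureReal_mono (μ := P) hsub).trans (h.decay 0 n)
    have h2 := Real.log_le_log (h.real_connected_pos y) h1
    rw [Real.log_mul h.prefactor_pos.ne' (Real.exp_pos _).ne', Real.log_exp] at h2
    have h3 := le_abs_self (Real.log ν₀)
    have h4 := mul_le_mul_of_nonneg_left hn1 h.rate_pos.le
    linarith

/-- The inverse correlation length exists, and is comparable to a norm. -/
theorem exists_invCorrLength_bounds (h : IsSubcritical C β q ν₀ ν₁ P) :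
    ∃ M : ℝ, 0 < M ∧ ∀ x : Eucl d, (∀ i, ν₁ * |x i| ≤ invCorrLength P x) ∧
      invCorrLength P x ≤ M * ∑ i, |x i| := by
  have := h.isProbabilityMeasure
  obtain ⟨M, hM, hup⟩ := h.exists_exp_le_real_connected
  obtain ⟨K, hK, hlow⟩ := h.exists_le_neg_log_connected
  refine ⟨M, hM, fun x => ?_⟩
  have hup : ∀ y : Site d, -Real.log (P.real (connected C 0 y)) ≤ M * ∑ i, |(y i : ℝ)| := by
    intro y
    have := (Real.le_log_iff_exp_le (h.real_connected_pos y)).2 (hup y)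
    linarith
  set a : ℕ → ℝ := fun k =>
    -Real.log (P.real (connected C 0 fun i => ⌊(k : ℝ) * x i⌋)) with ha
  -- Integer parts add up to within a vector with entries of modulus at most 1. Connecting across it
  -- costs at most M * d, which the added constant absorbs.
  have hsub : Subadditive fun k => a k + M * d := by
    intro k m
    set ε : Site d := fun i =>
      ⌊((k + m : ℕ) : ℝ) * x i⌋ - ⌊(k : ℝ) * x i⌋ - ⌊(m : ℝ) * x i⌋ with hε
    have hε1 : ∀ i, |(ε i : ℝ)| ≤ 1 := by
      intro i
      have h1 : ((k + m : ℕ) : ℝ) * x i = k * x i + m * x i := by push_cast; ring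
      have h2 := Int.le_floor_add (k * x i) (m * x i)
      have h3 := Int.le_floor_add_floor (k * x i) (m * x i)
      have h4 : |ε i| ≤ 1 := by
        rw [abs_le]
        simp only [hε, h1]
        constructor <;> omega
      exact_mod_cast h4
    have hdec : (fun i => ⌊((k + m : ℕ) : ℝ) * x i⌋ : Site d)
        = ((fun i => ⌊(k : ℝ) * x i⌋) + fun i => ⌊(m : ℝ) * x i⌋) + ε := by
      funext i
      simp only [Pi.add_apply, hε]
      ring
    have h5 : a (k + m) ≤ a k + a m + M * d := by
      simp only [ha]
      rw [hdec]
      refine (h.neg_log_connected_add_le _ ε).trans (add_le_add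
        (h.neg_log_connected_add_le _ _) ((hup ε).trans ?_))
      refine mul_le_mul_of_nonneg_left ((Finset.sum_le_sum fun i _ => hε1 i).trans ?_) hM.le
      simp
    beta_reduce
    linarith
  have ha0 : ∀ k, 0 ≤ a k := fun k =>
    neg_nonneg.2 (Real.log_nonpos measureReal_nonneg measureReal_le_one)
  have hlim := hsub.tendsto_lim ⟨0, by
    rintro _ ⟨k, rfl⟩
    have := ha0 k
    positivity⟩
  have hinv : Tendsto (fun k : ℕ => M * d / (k : ℝ)) atTop (𝓝 0) :=
    tendsto_const_div_atTop_nhds_zero_nat _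
  set L := hsub.lim with hL
  have hL' : Tendsto (fun k : ℕ => a k / k) atTop (𝓝 L) := by
    refine (by simpa using hlim.sub hinv : Tendsto _ atTop (𝓝 L)).congr fun k => ?_
    rw [add_div]
    ring
  -- `invCorrLength` is a `limUnder`, so it says something only now that the limit is known to
  -- exist.
  have hξ : invCorrLength P x = L := by
    refine Tendsto.limUnder_eq (hL'.congr fun k => ?_)
    simp only [ha]
    ring
  rw [hξ]
  constructor
  · intro i
    have h1 : Tendsto (fun k : ℕ => ν₁ * |x i| - (ν₁ + K) / k) atTop (𝓝 (ν₁ * |x i|)) := by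
      simpa using tendsto_const_nhds.sub
        (tendsto_const_div_atTop_nhds_zero_nat (ν₁ + K))
    refine le_of_tendsto_of_tendsto h1 hL' ((eventually_gt_atTop 0).mono fun k hk => ?_)
    have hk' : (0 : ℝ) < k := by exact_mod_cast hk
    beta_reduce
    rw [le_div_iff₀ hk', sub_mul, div_mul_cancel₀ _ hk'.ne']
    refine le_trans ?_ (hlow _)
    have h2 : k * |x i| - 1 ≤ ‖(fun i => ⌊(k : ℝ) * x i⌋ : Site d)‖ := by
      refine le_trans ?_ (norm_le_pi_norm (fun i => ⌊(k : ℝ) * x i⌋ : Site d) i)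
      rw [← Int.norm_cast_real, Real.norm_eq_abs]
      have h3 : |(k : ℝ) * x i| = k * |x i| := by rw [abs_mul, abs_of_pos hk']
      have h4 := Int.floor_le ((k : ℝ) * x i)
      have h5 := Int.lt_floor_add_one ((k : ℝ) * x i)
      have h6 := abs_sub_abs_le_abs_sub ((k : ℝ) * x i) (⌊(k : ℝ) * x i⌋ : ℝ)
      have h7 : |(k : ℝ) * x i - (⌊(k : ℝ) * x i⌋ : ℝ)| ≤ 1 := by
        rw [abs_le]; constructor <;> linarith
      linarith
    have h8 := mul_le_mul_of_nonneg_left h2 h.rate_pos.le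
    linarith
  · have h1 : Tendsto (fun k : ℕ => M * ∑ i, |x i| + M * d / k) atTop
        (𝓝 (M * ∑ i, |x i|)) := by
      simpa using tendsto_const_nhds.add hinv
    refine le_of_tendsto_of_tendsto hL' h1 ((eventually_gt_atTop 0).mono fun k hk => ?_)
    have hk' : (0 : ℝ) < k := by exact_mod_cast hk
    beta_reduce
    rw [div_le_iff₀ hk', add_mul, div_mul_cancel₀ _ hk'.ne', mul_assoc, ← mul_add]
    refine (hup _).trans (mul_le_mul_of_nonneg_left ?_ hM.le)
    have h2 : ∀ i, |(⌊(k : ℝ) * x i⌋ : ℝ)| ≤ |x i| * k + 1 := by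
      intro i
      have h3 : |(k : ℝ) * x i| = |x i| * k := by rw [abs_mul, abs_of_pos hk', mul_comm]
      have h4 := Int.floor_le ((k : ℝ) * x i)
      have h5 := Int.lt_floor_add_one ((k : ℝ) * x i)
      have h6 := abs_sub_abs_le_abs_sub (⌊(k : ℝ) * x i⌋ : ℝ) ((k : ℝ) * x i)
      have h7 : |(⌊(k : ℝ) * x i⌋ : ℝ) - (k : ℝ) * x i| ≤ 1 := by
        rw [abs_le]; constructor <;> linarith
      linarith
    refine (Finset.sum_le_sum fun i _ => h2 i).trans (le_of_eq ?_)
    rw [Finset.sum_add_distrib, Finset.sum_mul]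
    simp

end IsSubcritical

/-! ### Summability over sites and bonds. -/

section Sums

/-- Exponentials are summable over the lattice. -/
theorem exists_sum_exp_norm_le (hd : 1 ≤ d) {κ : ℝ} (hκ : 0 < κ) :
    ∃ G : ℝ, 0 < G ∧ ∀ U : Finset (Site d), ∑ u ∈ U, Real.exp (-κ * ‖u‖) ≤ G := by
  have hd0 : (0 : ℝ) < d := by exact_mod_cast hd
  -- The sup norm is at least the average of |u i|, so the exponential is bounded by a product of
  -- one-dimensional geometric weights. Averaging requires d ≥ 1.
  set r := Real.exp (-(κ / d)) with hr
  have hr0 : 0 < r := Real.exp_pos _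
  have hr1 : r < 1 := Real.exp_lt_one_iff.2 (neg_lt_zero.2 (div_pos hκ hd0))
  have hsum : Summable fun k : ℤ => r ^ k.natAbs := by
    refine Summable.of_nat_of_neg ?_ ?_ <;>
      simpa using summable_geometric_of_lt_one hr0.le hr1
  set Z := ∑' k : ℤ, r ^ k.natAbs with hZ
  have hZ0 : 0 ≤ Z := tsum_nonneg fun k => by positivity
  refine ⟨Z ^ d + 1, by positivity, fun U => ?_⟩
  set T : Finset ℤ := U.biUnion fun u => Finset.univ.image u with hT
  have hU : U ⊆ Fintype.piFinset fun _ : Fin d => T := fun u hu =>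
    Fintype.mem_piFinset.2 fun i =>
      Finset.mem_biUnion.2 ⟨u, hu, Finset.mem_image_of_mem u (Finset.mem_univ i)⟩
  have hpt : ∀ u : Site d, Real.exp (-κ * ‖u‖) ≤ ∏ i, r ^ (u i).natAbs := by
    intro u
    have h1 : ∀ i, r ^ (u i).natAbs = Real.exp (-(κ / d) * |(u i : ℝ)|) := by
      intro i
      rw [hr, ← Real.exp_nat_mul, Nat.cast_natAbs, Int.cast_abs, mul_comm]
    simp_rw [h1]
    rw [← Real.exp_sum, Real.exp_le_exp, ← Finset.mul_sum]
    have h2 : ∑ i, |(u i : ℝ)| ≤ d * ‖u‖ := by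
      refine (Finset.sum_le_card_nsmul _ _ ‖u‖ fun i _ => ?_).trans (by simp)
      have := norm_le_pi_norm u i
      rwa [← Int.norm_cast_real, Real.norm_eq_abs] at this
    have h3 : κ / d * ∑ i, |(u i : ℝ)| ≤ κ / d * (d * ‖u‖) :=
      mul_le_mul_of_nonneg_left h2 (div_pos hκ hd0).le
    have h4 : κ / d * (d * ‖u‖) = κ * ‖u‖ := by field_simp
    linarith
  calc ∑ u ∈ U, Real.exp (-κ * ‖u‖)
      ≤ ∑ u ∈ Fintype.piFinset fun _ : Fin d => T, ∏ i, r ^ (u i).natAbs :=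
        (Finset.sum_le_sum fun u _ => hpt u).trans
          (Finset.sum_le_sum_of_subset_of_nonneg hU fun u _ _ => by positivity)
    _ = ∏ _i : Fin d, ∑ k ∈ T, r ^ k.natAbs :=
        (Finset.prod_univ_sum (fun _ : Fin d => T) fun _ k => r ^ k.natAbs).symm
    _ ≤ ∏ _i : Fin d, Z := Finset.prod_le_prod
        (fun _ _ => Finset.sum_nonneg fun k _ => by positivity)
        fun _ _ => hsum.sum_le_tsum T fun k _ => by positivity
    _ = Z ^ d := by simp
    _ ≤ Z ^ d + 1 := by linarith

theorem card_bondsAt_singleton_le (C : Coupling d) (u : Site d) :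
    (bondsAt C {u}).card ≤ (box d ⌈C.R⌉₊).card := by
  have hsub : (bondsAt C {u}).image Subtype.val
      ⊆ (box d ⌈C.R⌉₊).image fun z => s(u, u + z) := by
    intro e he
    obtain ⟨e, he', rfl⟩ := Finset.mem_image.1 he
    obtain ⟨x, hx, hxe⟩ := mem_bondsAt.1 he'
    rw [Finset.mem_singleton] at hx
    subst hx
    obtain ⟨y, hy⟩ := hxe
    refine Finset.mem_image.2 ⟨y - x, mem_box.2 ?_, by simp [hy]⟩
    exact (norm_sub_le_of_bond (hy ▸ e.2)).trans (Nat.le_ceil _)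
  rw [← Finset.card_image_of_injective _ Subtype.val_injective]
  exact (Finset.card_le_card hsub).trans Finset.card_image_le

/-- Exponentials are summable over bonds. -/
theorem exists_sum_bonds_exp_le (C : Coupling d) (hd : 1 ≤ d) {κ : ℝ} (hκ : 0 < κ) :
    ∃ G : ℝ, 0 < G ∧ ∀ (D : Finset (Bond C)) (x : Bond C → Site d) (v : Site d),
      (∀ e ∈ D, x e ∈ e.1) → ∑ e ∈ D, Real.exp (-κ * ‖x e - v‖) ≤ G := by
  obtain ⟨G, hG, hle⟩ := exists_sum_exp_norm_le hd hκ
  set B := (box d ⌈C.R⌉₊).card with hB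
  refine ⟨(B + 1) * G, by positivity, fun D x v hx => ?_⟩
  -- Group the bonds by their chosen endpoint. Finite range leaves boundedly many at each site.
  have h1 := Finset.sum_comp (s := D) (fun u : Site d => Real.exp (-κ * ‖u - v‖)) x
  rw [h1]
  calc ∑ u ∈ D.image x, (D.filter fun e => x e = u).card • Real.exp (-κ * ‖u - v‖)
      ≤ ∑ u ∈ D.image x, B * Real.exp (-κ * ‖u - v‖) := by
        refine Finset.sum_le_sum fun u _ => ?_
        rw [nsmul_eq_mul]
        refine mul_le_mul_of_nonneg_right ?_ (Real.exp_pos _).le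
        have : (D.filter fun e => x e = u) ⊆ bondsAt C {u} := fun e he => by
          obtain ⟨he', rfl⟩ := Finset.mem_filter.1 he
          exact mem_bondsAt.2 ⟨x e, by simp, hx e he'⟩
        exact_mod_cast (Finset.card_le_card this).trans (card_bondsAt_singleton_le C u)
    _ = B * ∑ u ∈ (D.image x).image (· - v), Real.exp (-κ * ‖u‖) := by
        rw [← Finset.mul_sum, Finset.sum_image fun a _ b _ hab => sub_left_injective hab]
    _ ≤ B * G := mul_le_mul_of_nonneg_left (hle _) (Nat.cast_nonneg _)
    _ ≤ (B + 1) * G := by nlinarith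

end Sums

/-! ### Cone geometry and mixing across a cone point. -/

section Slope

/-- The component of a lattice site in the direction of `t`. -/
def slope (t : Eucl d) (x : Site d) : ℝ := inner ℝ t (toEucl x)

theorem toEucl_add (x y : Site d) : toEucl (x + y) = toEucl x + toEucl y := by
  ext i
  simp [toEucl_apply]

theorem slope_add (t : Eucl d) (x y : Site d) : slope t (x + y) = slope t x + slope t y := by
  rw [slope, toEucl_add, inner_add_right]; rfl

theorem slope_zero (t : Eucl d) : slope t (0 : Site d) = 0 := by
  have := slope_add t 0 0
  rw [add_zero] at this
  linarith

theorem slope_sub (t : Eucl d) (x y : Site d) : slope t (x - y) = slope t x - slope t y := by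
  have := slope_add t (x - y) y
  rw [sub_add_cancel] at this
  linarith

theorem slope_le (t : Eucl d) (x : Site d) : slope t x ≤ d * ‖t‖ * ‖x‖ := by
  rw [slope, PiLp.inner_apply, mul_assoc]
  refine (Finset.sum_le_card_nsmul _ _ (‖t‖ * ‖x‖) fun i _ => ?_).trans (by simp)
  refine (real_inner_le_norm _ _).trans (mul_le_mul (PiLp.norm_apply_le t i) ?_
    (norm_nonneg _) (norm_nonneg _))
  rw [toEucl_apply, Int.norm_cast_real]
  exact norm_le_pi_norm x i

theorem one_le_norm_of_ne_zero {x : Site d} (hx : x ≠ 0) : 1 ≤ ‖x‖ := by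
  obtain ⟨i, hi⟩ := Function.ne_iff.1 hx
  refine le_trans ?_ (norm_le_pi_norm x i)
  rw [Int.norm_eq_abs]
  exact_mod_cast Int.one_le_abs hi

/-- The cone of opening `δ` in direction `t` lies in the circular cone of slope `c`. -/
def ConeBound (ξ : Eucl d → ℝ) (t : Eucl d) (δ c : ℝ) : Prop :=
  ∀ x ∈ forwardCone ξ t δ, c * ‖x‖ ≤ slope t x

theorem ConeBound.insert {ξ : Eucl d → ℝ} {t : Eucl d} {δ c : ℝ} (h : ConeBound ξ t δ c)
    {x : Site d} (hx : x ∈ insert 0 (forwardCone ξ t δ)) : c * ‖x‖ ≤ slope t x := by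
  rcases hx with rfl | hx
  · rw [norm_zero, mul_zero, slope_zero]
  · exact h x hx

end Slope

namespace IsSubcritical

variable {β q ν₀ ν₁ : ℝ} {P : Measure (Config C)}

theorem coneBound (h : IsSubcritical C β q ν₀ ν₁ P) (hd : 1 ≤ d) {δ : ℝ} (hδ : δ < 1)
    (t : Eucl d) : ConeBound (invCorrLength P) t δ ((1 - δ) * ν₁) := by
  obtain ⟨M, -, hM⟩ := h.exists_invCorrLength_bounds
  intro x hx
  have hx : invCorrLength P (toEucl x) - slope t x < δ * invCorrLength P (toEucl x) := hx
  have hi : ∀ i, (1 - δ) * ν₁ * |(x i : ℝ)| ≤ slope t x := by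
    intro i
    have h1 := (hM (toEucl x)).1 i
    rw [toEucl_apply] at h1
    have h2 := mul_le_mul_of_nonneg_left h1 (sub_pos.2 hδ).le
    linarith
  have hc : 0 < (1 - δ) * ν₁ := mul_pos (sub_pos.2 hδ) h.rate_pos
  have h0 : 0 ≤ slope t x := le_trans (by positivity) (hi ⟨0, hd⟩)
  rw [mul_comm, ← le_div_iff₀ hc, pi_norm_le_iff_of_nonneg (by positivity)]
  intro i
  rw [le_div_iff₀ hc, mul_comm, ← Int.norm_cast_real, Real.norm_eq_abs]
  exact hi i

theorem exists_slope_le (h : IsSubcritical C β q ν₀ ν₁ P) :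
    ∃ M : ℝ, 0 < M ∧ ∀ t ∈ frontier (wulffShape (invCorrLength P)), ∀ x : Site d,
      slope t x ≤ M * ‖x‖ := by
  obtain ⟨M, hM0, hM⟩ := h.exists_invCorrLength_bounds
  refine ⟨d * (M * d) + 1, by positivity, fun t ht x => ?_⟩
  have hclosed : IsClosed (wulffShape (invCorrLength P)) := by
    have : wulffShape (invCorrLength P)
        = ⋂ (n : Eucl d) (_ : ‖n‖ = 1), {t | inner ℝ t n ≤ invCorrLength P n} := by
      ext t; simp [wulffShape]
    rw [this]
    exact isClosed_iInter fun n => isClosed_iInter fun _ =>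
      isClosed_le (by fun_prop) continuous_const
  have htK : t ∈ wulffShape (invCorrLength P) := hclosed.frontier_subset ht
  have ht : ‖t‖ ≤ M * d := by
    rcases eq_or_ne t 0 with rfl | ht0
    · rw [norm_zero]; positivity
    · have hn : ‖(‖t‖⁻¹ : ℝ) • t‖ = 1 := norm_smul_inv_norm ht0
      have h1 := htK _ hn
      rw [inner_smul_right, real_inner_self_eq_norm_sq, sq, ← mul_assoc,
        inv_mul_cancel₀ (norm_ne_zero_iff.2 ht0), one_mul] at h1
      refine h1.trans ((hM _).2.trans (mul_le_mul_of_nonneg_left ?_ hM0.le))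
      refine (Finset.sum_le_card_nsmul _ _ 1 fun i _ => ?_).trans (by simp)
      have := PiLp.norm_apply_le ((‖t‖⁻¹ : ℝ) • t) i
      rwa [hn, Real.norm_eq_abs] at this
  refine (slope_le t x).trans (mul_le_mul_of_nonneg_right ?_ (norm_nonneg _))
  have := mul_le_mul_of_nonneg_left ht (Nat.cast_nonneg (α := ℝ) d)
  linarith

/-- Ratio mixing for bonds that are separated by a pair of opposite cones and a gap of
width `n`. -/
theorem exists_cone_mixing (h : IsSubcritical C β q ν₀ ν₁ P) (hd : 1 ≤ d) {c : ℝ} (hc : 0 < c) :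
    ∃ B κ : ℝ, 0 < B ∧ 0 < κ ∧ ∀ t ∈ frontier (wulffShape (invCorrLength P)),
      ∀ (v : Site d) (D S E : Finset (Bond C)) (n : ℕ),
      (∀ e ∈ D, ∃ u ∈ e.1, c * ‖u - v‖ ≤ slope t (v - u)) →
      (∀ e ∈ E, ∃ u ∈ e.1, c * n ≤ slope t (u - v)) →
      0 ≤ logClosed P (D ∪ (S ∪ E)) - logClosed P (S ∪ E)
        - logClosed P (D ∪ S) + logClosed P S ∧
      logClosed P (D ∪ (S ∪ E)) - logClosed P (S ∪ E)
        - logClosed P (D ∪ S) + logClosed P S ≤ B * Real.exp (-κ * n) := by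
  obtain ⟨K, hK, hb⟩ := h.exists_logClosed_union_bounds
  obtain ⟨M, hM, hslope⟩ := h.exists_slope_le
  have hν₁ := h.rate_pos
  -- Slope changes by at most M per unit of distance, so a slope gap of c(n + r) forces the distance
  -- c(n + r)/M.
  set κ := ν₁ * (c / M) with hκ
  have hκ0 : 0 < κ := by positivity
  obtain ⟨G, hG, hsum⟩ := exists_sum_bonds_exp_le C hd hκ0
  refine ⟨K * (Real.exp (ν₁ * C.R) * G), κ, by positivity, hκ0, fun t ht v D S E n hD hE => ?_⟩
  choose! x hxe hx using hD
  -- The hypothesis locates one endpoint of each bond of E. The other may be nearer by R.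
  obtain ⟨h1, h2⟩ := hb D S E x (fun e => c / M * (n + ‖x e - v‖) - C.R) fun e he => by
    refine ⟨hxe e he, fun e' he' y hy => ?_⟩
    obtain ⟨u, hu, hun⟩ := hE e' he'
    have h3 := hslope t ht (u - x e)
    have h4 := hx e he
    rw [slope_sub] at h3 h4 hun
    have h5 : c / M * (n + ‖x e - v‖) ≤ ‖u - x e‖ := by
      rw [div_mul_eq_mul_div, div_le_iff₀ hM, mul_comm ‖u - x e‖]
      linarith
    have h6 := norm_sub_le_of_mem_bond e' hy hu
    have h7 : ‖u - x e‖ ≤ ‖u - y‖ + ‖y - x e‖ := by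
      rw [← sub_add_sub_cancel u y (x e)]
      exact norm_add_le _ _
    linarith
  refine ⟨h1, h2.trans ?_⟩
  rw [mul_assoc]
  refine mul_le_mul_of_nonneg_left ?_ hK.le
  have h3 : ∀ e, Real.exp (-ν₁ * (c / M * (n + ‖x e - v‖) - C.R))
      = Real.exp (ν₁ * C.R) * Real.exp (-κ * n) * Real.exp (-κ * ‖x e - v‖) := by
    intro e
    rw [← Real.exp_add, ← Real.exp_add, hκ]
    ring_nf
  simp_rw [h3]
  rw [← Finset.mul_sum, mul_right_comm]
  refine mul_le_mul_of_nonneg_right (mul_le_mul_of_nonneg_left (hsum D x v hxe)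
    (Real.exp_pos _).le) (Real.exp_pos _).le

end IsSubcritical

/-! ### Bonds closed along a concatenation of clusters. -/

section Chains

variable {ξ : Eucl d → ℝ} {t : Eucl d} {δ c : ℝ}

theorem exists_closedOn_eq_allClosed {A : Set (Sym2 (Site d))} (hA : A.Finite) :
    ∃ F : Finset (Bond C), closedOn F = allClosed C A ∧ ∀ e ∈ F, e.1 ∈ A := by
  have hfin : {e : Bond C | e.1 ∈ A}.Finite := hA.preimage Subtype.val_injective.injOn
  refine ⟨hfin.toFinset, ?_, fun e he => by simpa using he⟩
  ext ω
  simp [closedOn, allClosed]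

theorem finite_boundaryBonds (γ : Cluster C) : γ.boundaryBonds.Finite := by
  refine ((bondsAt C γ.verts).image Subtype.val).finite_toSet.subset ?_
  rintro e ⟨h, ⟨u, hu, hue⟩, -⟩
  exact Finset.mem_coe.2 (Finset.mem_image.2 ⟨⟨e, h⟩, mem_bondsAt.2 ⟨u, hu, hue⟩, rfl⟩)

theorem IrredCluster.exists_closedBonds (γ : IrredCluster C ξ t δ)
    (h : ConeBound ξ t (3 * δ) c) :
    ∃ F : Finset (Bond C), closedOn F = allClosed C γ.closedBonds ∧
      ∀ e ∈ F, ∃ u ∈ e.1, c * ‖u - γ.displacement‖ ≤ slope t (γ.displacement - u) := by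
  obtain ⟨F, hF, hmem⟩ := exists_closedOn_eq_allClosed (C := C)
    ((finite_boundaryBonds γ.cluster).subset sdiff_subset :
      γ.closedBonds.Finite)
  refine ⟨F, hF, fun e he => ?_⟩
  obtain ⟨⟨-, ⟨u, hu, hue⟩, -⟩, -⟩ := hmem e he
  refine ⟨u, hue, ?_⟩
  rw [norm_sub_rev]
  exact h.insert (γ.irred.2.2.2.2.1 u hu)

theorem BackwardCluster.exists_closedBonds (γ : BackwardCluster C ξ t δ)
    (h : ConeBound ξ t (3 * δ) c) :
    ∃ F : Finset (Bond C), closedOn F = allClosed C γ.closedBonds ∧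
      ∀ e ∈ F, ∃ u ∈ e.1, c * ‖u - 0‖ ≤ slope t (0 - u) := by
  obtain ⟨F, hF, hmem⟩ := exists_closedOn_eq_allClosed (C := C)
    ((finite_boundaryBonds γ.cluster).subset sdiff_subset :
      γ.closedBonds.Finite)
  refine ⟨F, hF, fun e he => ?_⟩
  obtain ⟨⟨-, ⟨u, hu, hue⟩, -⟩, -⟩ := hmem e he
  refine ⟨u, hue, ?_⟩
  rw [norm_sub_rev]
  exact h.insert (γ.irred.2.2.1 u hu)

theorem exists_shift_boundaryBonds {γ : Cluster C} {A : Set (Sym2 (Site d))}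
    (hA : A ⊆ γ.boundaryBonds) (v : Site d) (h : ∀ x ∈ γ.verts, 0 ≤ slope t x) :
    ∃ F : Finset (Bond C), closedOn F = allClosed C (shift v A) ∧
      ∀ e ∈ F, ∃ u ∈ e.1, 0 ≤ slope t (u - v) := by
  obtain ⟨F, hF, hmem⟩ := exists_closedOn_eq_allClosed (C := C)
    (((finite_boundaryBonds γ).subset hA).image (Sym2.map fun x => v + x))
  refine ⟨F, hF, fun e he => ?_⟩
  obtain ⟨e', he', heq⟩ := hmem e he
  obtain ⟨-, ⟨u, hu, hue⟩, -⟩ := hA he'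
  refine ⟨v + u, ?_, ?_⟩
  · rw [← heq, Sym2.mem_map]
    exact ⟨u, hue, rfl⟩
  · rw [add_sub_cancel_left]
    exact h u hu

theorem IrredCluster.slope_nonneg (γ : IrredCluster C ξ t δ) (h : ConeBound ξ t (3 * δ) c)
    (hc : 0 ≤ c) : ∀ x ∈ γ.cluster.verts, 0 ≤ slope t x := by
  intro x hx
  have := h.insert (γ.irred.2.2.2.2.2.1 x hx)
  rw [sub_zero] at this
  exact le_trans (by positivity) this

/-- The displacement is a nonzero lattice vector in the cone. Each cluster thus advances the slope
by at least c, which turns the number of clusters into distance. -/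
theorem IrredCluster.le_slope_displacement (γ : IrredCluster C ξ t δ)
    (h : ConeBound ξ t (3 * δ) c) (hc : 0 ≤ c) : c ≤ slope t γ.displacement := by
  have h1 := h.insert (γ.irred.2.2.2.2.2.1 γ.displacement γ.irred.2.2.1)
  rw [sub_zero] at h1
  have h2 := one_le_norm_of_ne_zero γ.irred.2.2.2.1.symm
  nlinarith

theorem exists_chainClosed (h : ConeBound ξ t (3 * δ) c) (hc : 0 ≤ c)
    (r : List (IrredCluster C ξ t δ)) (γf : ForwardCluster C ξ t δ) (v : Site d) :
    ∃ E : Finset (Bond C), closedOn E = chainClosed v r γf ∧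
      ∀ e ∈ E, ∃ u ∈ e.1, 0 ≤ slope t (u - v) := by
  induction r generalizing v with
  | nil =>
    refine exists_shift_boundaryBonds (γ := γf.cluster) sdiff_subset v fun x hx => ?_
    have := h.insert (γf.irred.2.2.1 x hx)
    rw [sub_zero] at this
    exact le_trans (by positivity) this
  | cons γ r ih =>
    obtain ⟨E, hE, hE'⟩ := ih (v + γ.displacement)
    obtain ⟨F, hF, hF'⟩ := exists_shift_boundaryBonds (γ := γ.cluster) (A := γ.closedBonds)
      sdiff_subset v (γ.slope_nonneg h hc)
    refine ⟨F ∪ E, by rw [closedOn_union, hF, hE]; rfl, fun e he => ?_⟩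
    rcases Finset.mem_union.1 he with he | he
    · exact hF' e he
    · obtain ⟨u, hu, hus⟩ := hE' e he
      have := γ.le_slope_displacement h hc
      refine ⟨u, hu, ?_⟩
      rw [slope_sub, slope_add] at hus
      rw [slope_sub]
      linarith

/-- In a concatenation, the clusters after a common initial string `l` contribute bonds that are
far ahead of the starting point. -/
theorem exists_chainClosed_append (h : ConeBound ξ t (3 * δ) c) (hc : 0 ≤ c)
    (l : List (IrredCluster C ξ t δ)) (v : Site d) :
    ∃ S : Finset (Bond C), ∀ (r : List (IrredCluster C ξ t δ)) (γf : ForwardCluster C ξ t δ),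
      ∃ E : Finset (Bond C), closedOn (S ∪ E) = chainClosed v (l ++ r) γf ∧
        ∀ e ∈ E, ∃ u ∈ e.1, c * l.length ≤ slope t (u - v) := by
  induction l generalizing v with
  | nil =>
    refine ⟨∅, fun r γf => ?_⟩
    simpa using exists_chainClosed h hc r γf v
  | cons γ l ih =>
    obtain ⟨S, hS⟩ := ih (v + γ.displacement)
    obtain ⟨F, hF, -⟩ := exists_shift_boundaryBonds (γ := γ.cluster) (A := γ.closedBonds)
      sdiff_subset v (γ.slope_nonneg h hc)
    -- This set is fixed before r and γf, so all continuations of the same string share it.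
    refine ⟨F ∪ S, fun r γf => ?_⟩
    obtain ⟨E, hE, hE'⟩ := hS r γf
    refine ⟨E, ?_, fun e he => ?_⟩
    · rw [Finset.union_assoc, closedOn_union, hF, hE]
      rfl
    · obtain ⟨u, hu, hus⟩ := hE' e he
      have := γ.le_slope_displacement h hc
      refine ⟨u, hu, ?_⟩
      rw [slope_sub, slope_add] at hus
      rw [slope_sub, List.length_cons]
      push_cast
      linarith

/-- Positions are counted from 1, so only the first i - 1 entries are certain to agree. The lengths
in the definition ensure that these entries exist. -/
theorem exists_common_prefix {α : Type*} (l l' : List α) :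
    ∃ p r r' : List α, l = p ++ r ∧ l' = p ++ r' ∧ firstDisagreement l l' ≤ p.length + 1 := by
  set i := firstDisagreement l l' with hi
  have hl : i ≤ l.length := Nat.sInf_le (Or.inr (Or.inl rfl))
  have hl' : i ≤ l'.length := Nat.sInf_le (Or.inr (Or.inr rfl))
  have heq : ∀ j, j + 1 < i → l[j]? = l'[j]? := by
    intro j hj
    by_contra hne
    exact Nat.notMem_of_lt_sInf hj (Or.inl ⟨Nat.le_add_left 1 j, by simpa using hne⟩)
  have htake : l.take (i - 1) = l'.take (i - 1) := by
    refine List.ext_getElem? fun j => ?_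
    rw [List.getElem?_take, List.getElem?_take]
    split_ifs with hj
    · exact heq j (by omega)
    · rfl
  refine ⟨l.take (i - 1), l.drop (i - 1), l'.drop (i - 1), (List.take_append_drop _ _).symm, ?_, ?_⟩
  · rw [htake, List.take_append_drop]
  · rw [List.length_take]
    omega

end Chains

/-- The exponential is Lipschitz with constant exp c on the half-line up to c. -/
theorem abs_exp_sub_exp_le {a b c : ℝ} (ha : a ≤ c) (hb : b ≤ c) :
    |Real.exp a - Real.exp b| ≤ Real.exp c * |a - b| := by
  have key : ∀ x y : ℝ, y ≤ x → x ≤ c → Real.exp x - Real.exp y ≤ Real.exp c * (x - y) := by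
    intro x y hxy hx
    have h1 := Real.add_one_le_exp (y - x)
    have h2 : Real.exp y = Real.exp x * Real.exp (y - x) := by
      rw [← Real.exp_add, add_sub_cancel]
    have h3 := Real.exp_le_exp.2 hx
    have h4 := Real.exp_pos x
    have h5 : Real.exp x - Real.exp y ≤ Real.exp x * (x - y) := by rw [h2]; nlinarith
    exact h5.trans (mul_le_mul_of_nonneg_right h3 (sub_nonneg.2 hxy))
  rcases le_total a b with hab | hab
  · rw [abs_sub_comm, abs_sub_comm a, abs_of_nonneg (sub_nonneg.2 (Real.exp_le_exp.2 hab)),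
      abs_of_nonneg (sub_nonneg.2 hab)]
    exact key b a hab hb
  · rw [abs_of_nonneg (sub_nonneg.2 (Real.exp_le_exp.2 hab)), abs_of_nonneg (sub_nonneg.2 hab)]
    exact key a b hab ha

/-! ### Conditional probabilities as differences of `logClosed`. -/

namespace IsSubcritical

variable {β q ν₀ ν₁ : ℝ} {P : Measure (Config C)}

theorem condProb_closedOn (h : IsSubcritical C β q ν₀ ν₁ P) (D T : Finset (Bond C)) :
    condProb P (closedOn D) (closedOn T) = Real.exp (logClosed P (D ∪ T) - logClosed P T) := by
  rw [condProb, ← closedOn_union, Real.exp_sub, logClosed, logClosed,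
    Real.exp_log (h.real_closedOn_pos _), Real.exp_log (h.real_closedOn_pos _)]

theorem logClosed_empty (h : IsSubcritical C β q ν₀ ν₁ P) :
    logClosed P (∅ : Finset (Bond C)) = 0 := by
  have := h.isProbabilityMeasure
  rw [logClosed, closedOn_empty, probReal_univ, Real.log_one]

theorem condProb_div_closedOn (h : IsSubcritical C β q ν₀ ν₁ P) (D T : Finset (Bond C)) :
    condProb P (closedOn D) (closedOn T) / P.real (closedOn D)
      = Real.exp (logClosed P (D ∪ T) - logClosed P T - logClosed P D) := by
  rw [h.condProb_closedOn, Real.exp_sub _ (logClosed P D), logClosed, logClosed, logClosed,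
    Real.exp_log (h.real_closedOn_pos D)]

end IsSubcritical

end

end FK

/-! ### The theorem. -/

theorem theorem3p1 (d : ℕ) (hd : 1 ≤ d) (C : FK.Coupling d) (β q : ℝ) (hβ : 0 < β) (hq : 1 ≤ q)
    (hβc : (β : EReal) < FK.betaHat C q)
    (P : MeasureTheory.Measure (FK.Config C)) (hP : FK.IsRandomClusterMeasure C β q P)
    (δ : ℝ) (hδ : 0 < δ) (hδ' : δ < 1 / 3) :
    ∃ θ ν₈ ν₉ : ℝ, 0 < θ ∧ θ < 1 ∧ 0 < ν₈ ∧ 0 < ν₉ ∧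
      ∀ t ∈ frontier (FK.wulffShape (FK.invCorrLength P)),
        (∀ (γs : List (FK.IrredCluster C (FK.invCorrLength P) t δ))
          (γb : FK.BackwardCluster C (FK.invCorrLength P) t δ)
          (γf : FK.ForwardCluster C (FK.invCorrLength P) t δ),
          ν₈ ≤ FK.g P γs γb γf ∧ FK.g P γs γb γf ≤ 1 / ν₈) ∧
        (∀ (γ : FK.IrredCluster C (FK.invCorrLength P) t δ)
          (γs lams : List (FK.IrredCluster C (FK.invCorrLength P) t δ))
          (γb : FK.BackwardCluster C (FK.invCorrLength P) t δ)
          (γf γf' : FK.ForwardCluster C (FK.invCorrLength P) t δ),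
          |FK.g P (γ :: γs) γb γf - FK.g P (γ :: lams) γb γf'|
            ≤ ν₉ * θ ^ FK.firstDisagreement γs lams) ∧
        (∀ (γ : FK.IrredCluster C (FK.invCorrLength P) t δ)
          (γs lams : List (FK.IrredCluster C (FK.invCorrLength P) t δ))
          (γf γf' : FK.ForwardCluster C (FK.invCorrLength P) t δ),
          |FK.psi β q P γ γs γf - FK.psi β q P γ lams γf'|
            ≤ ν₉ * θ ^ FK.firstDisagreement γs lams) := by
  obtain ⟨ν₀, ν₁, h0, h1, hdec⟩ := hP.exists_uniformDecay hβ.le hq hβc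
  have hsub : FK.IsSubcritical C β q ν₀ ν₁ P := ⟨hP, hβ, hq, h0, h1, hdec⟩
  have hc : 0 < (1 - 3 * δ) * ν₁ := mul_pos (by linarith) h1
  set c := (1 - 3 * δ) * ν₁
  obtain ⟨B, κ, hB, hκ, hmix⟩ := hsub.exists_cone_mixing hd hc
  have hθ : ∀ (k i : ℕ), i ≤ k + 1 → Real.exp (-κ * k) ≤ Real.exp κ * Real.exp (-κ) ^ i := by
    intro k i hik
    have hik' : (i : ℝ) ≤ k + 1 := by exact_mod_cast hik
    rw [← Real.exp_nat_mul, ← Real.exp_add, Real.exp_le_exp]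
    nlinarith
  have hBκ : 0 < B * Real.exp κ := by positivity
  -- θ is the mixing rate per cluster. The exponent of g lies in [0, B], giving ν₈ and the Lipschitz
  -- factor exp B in ν₉, and exp κ pays for the off-by-one in the length of the common prefix.
  refine ⟨Real.exp (-κ), Real.exp (-B), Real.exp B * (B * Real.exp κ), Real.exp_pos _,
    Real.exp_lt_one_iff.2 (by linarith), Real.exp_pos _, by positivity, fun t ht => ?_⟩
  have hcone := hsub.coneBound hd (δ := 3 * δ) (by linarith) t
  -- Two conditions that agree up to a distance have nearly the same effect.
  have hdiff : ∀ (v : FK.Site d) (D S E E' : Finset (FK.Bond C)) (k i : ℕ), i ≤ k + 1 →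
      (∀ e ∈ D, ∃ u ∈ e.1, c * ‖u - v‖ ≤ FK.slope t (v - u)) →
      (∀ e ∈ E, ∃ u ∈ e.1, c * k ≤ FK.slope t (u - v)) →
      (∀ e ∈ E', ∃ u ∈ e.1, c * k ≤ FK.slope t (u - v)) →
      |(FK.logClosed P (D ∪ (S ∪ E)) - FK.logClosed P (S ∪ E))
        - (FK.logClosed P (D ∪ (S ∪ E')) - FK.logClosed P (S ∪ E'))|
        ≤ B * Real.exp κ * Real.exp (-κ) ^ i := by
    intro v D S E E' k i hik hD hE hE'
    obtain ⟨a1, a2⟩ := hmix t ht v D S E k hD hE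
    obtain ⟨b1, b2⟩ := hmix t ht v D S E' k hD hE'
    have := mul_le_mul_of_nonneg_left (hθ k i hik) hB.le
    rw [abs_le]
    constructor <;> linarith
  have hg : ∀ (γs : List (FK.IrredCluster C (FK.invCorrLength P) t δ))
      (γf : FK.ForwardCluster C (FK.invCorrLength P) t δ) (D T : Finset (FK.Bond C)),
      (∀ e ∈ D, ∃ u ∈ e.1, c * ‖u - 0‖ ≤ FK.slope t (0 - u)) →
      FK.closedOn T = FK.chainClosed 0 γs γf →
      0 ≤ FK.logClosed P (D ∪ T) - FK.logClosed P T - FK.logClosed P D ∧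
      FK.logClosed P (D ∪ T) - FK.logClosed P T - FK.logClosed P D ≤ B := by
    intro γs γf D T hD hT
    obtain ⟨E, hE, hE'⟩ := FK.exists_chainClosed hcone hc.le γs γf 0
    -- With empty background and zero gap, the second difference is the exponent of g.
    have key := hmix t ht 0 D ∅ E 0 hD (by simpa using hE')
    -- T and E may differ as sets, but they define the same event, and `logClosed` sees only that.
    have e1 : FK.logClosed P T = FK.logClosed P E := by rw [FK.logClosed, hT, ← hE]; rfl
    have e2 : FK.logClosed P (D ∪ T) = FK.logClosed P (D ∪ E) := by
      rw [FK.logClosed, FK.logClosed, FK.closedOn_union, FK.closedOn_union, hT, hE]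
    rw [Finset.empty_union, Finset.union_empty, hsub.logClosed_empty, ← e1, ← e2] at key
    simp only [CharP.cast_eq_zero, mul_zero, Real.exp_zero, mul_one, add_zero] at key
    exact key
  refine ⟨fun γs γb γf => ?_, fun γ γs lams γb γf γf' => ?_, fun γ γs lams γf γf' => ?_⟩
  · obtain ⟨D, hD, hDc⟩ := γb.exists_closedBonds hcone
    obtain ⟨T, hT, -⟩ := FK.exists_chainClosed hcone hc.le γs γf 0
    obtain ⟨l1, l2⟩ := hg γs γf D T hDc hT
    rw [FK.g, ← hD, ← hT, hsub.condProb_div_closedOn, one_div, ← Real.exp_neg, neg_neg]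
    exact ⟨Real.exp_le_exp.2 (by linarith), Real.exp_le_exp.2 l2⟩
  · obtain ⟨D, hD, hDc⟩ := γb.exists_closedBonds hcone
    obtain ⟨p, r, r', rfl, rfl, hlen⟩ := FK.exists_common_prefix γs lams
    obtain ⟨S, hS⟩ := FK.exists_chainClosed_append hcone hc.le (γ :: p) 0
    obtain ⟨E, hE, hEc⟩ := hS r γf
    obtain ⟨E', hE', hEc'⟩ := hS r' γf'
    have l1 := (hg _ γf D _ hDc hE).2
    have l2 := (hg _ γf' D _ hDc hE').2
    rw [List.cons_append] at hE hE'
    rw [FK.g, FK.g, ← hD, ← hE, ← hE', hsub.condProb_div_closedOn, hsub.condProb_div_closedOn]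
    refine (FK.abs_exp_sub_exp_le l1 l2).trans ?_
    rw [mul_assoc (Real.exp B), sub_sub_sub_cancel_right]
    refine mul_le_mul_of_nonneg_left ?_ (Real.exp_pos _).le
    -- The leading γ lengthens the common part by one, more than is needed.
    exact hdiff 0 D S E E' _ _ (hlen.trans (by simp)) hDc hEc hEc'
  · obtain ⟨D, hD, hDc⟩ := γ.exists_closedBonds hcone
    obtain ⟨p, r, r', rfl, rfl, hlen⟩ := FK.exists_common_prefix γs lams
    obtain ⟨S, hS⟩ := FK.exists_chainClosed_append hcone hc.le p γ.displacement
    obtain ⟨E, hE, hEc⟩ := hS r γf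
    obtain ⟨E', hE', hEc'⟩ := hS r' γf'
    rw [FK.psi, FK.psi, ← hD, ← hE, ← hE', hsub.condProb_closedOn, hsub.condProb_closedOn]
    have hB1 : B * Real.exp κ ≤ Real.exp B * (B * Real.exp κ) :=
      le_mul_of_one_le_left hBκ.le (Real.one_le_exp hB.le)
    -- The prefactor is common to both terms. If it vanished, both logarithms would be `Real.log 0`,
    -- so its positivity need not be shown.
    by_cases hz : Real.exp (inner ℝ t (FK.toEucl γ.displacement)) *
        (FK.freeMeasure β q γ.cluster).real γ.cluster.allOpen = 0
    · rw [hz, zero_mul, zero_mul, sub_self, abs_zero]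
      positivity
    · rw [Real.log_mul hz (Real.exp_pos _).ne', Real.log_mul hz (Real.exp_pos _).ne',
        Real.log_exp, Real.log_exp, add_sub_add_left_eq_sub]
      exact (hdiff γ.displacement D S E E' _ _ hlen hDc hEc hEc').trans
        (mul_le_mul_of_nonneg_right hB1 (by positivity))
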